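/- Let $0<r<1$, let $H$ be a complex Hilbert space, and let $T$ be a bounded invertible linear operator on $H$ such that $$\alpha(T^*,T):=-T^{*2}T^2+(1+r^2)\,T^*T-r^2 I\ \ge\ 0$$ (that is, $T$ belongs to the class $\mathbf{C}_\alpha$). Then the closed annulus $\overline{\mathbb{A}}=\{z\in\mathbb{C}: r\le |z|\le 1\}$ is a complete $\sqrt2$-spectral set for $T$. This means that the spectrum of $T$ is contained in $\overline{\mathbb{A}}$ and that, for every $n$ and every $n\times n$ matrix-valued rational function $F=(f_{ij})$ with poles outside $\overline{\mathbb{A}}$, $$\|F(T)\|\le \sqrt2\,\max_{z\in\overline{\mathbb{A}}}\|F(z)\|,$$ where $F(T)=(f_{ij}(T))$ acts on the Hilbert space direct sum $H^n=H\oplus\cdots\oplus H$, $\|F(T)\|$ is its operator norm, and $\|F(z)\|$ is the operator norm of the matrix $F(z)$ on Euclidean $\mathbb{C}^n$. -/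

import Mathlib

noncomputable section

namespace AnnulusModel

variable {H : Type*} [NormedAddCommGroup H] [InnerProductSpace ℂ H]

/-- The closed annulus `r ≤ |z| ≤ 1` in the complex plane. -/
def closedAnnulus (r : ℝ) : Set ℂ := {z : ℂ | r ≤ ‖z‖ ∧ ‖z‖ ≤ 1}

/-- The hereditary expression `α(T*, T) = -T*² T² + (1 + r²) T* T - r² I`, for
`α(t) = (1 - t) (t - r²)`. -/
def alphaOp [CompleteSpace H] (r : ℝ) (T : H →L[ℂ] H) : H →L[ℂ] H :=
  -((ContinuousLinearMap.adjoint T) ^ 2 * T ^ 2)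
    + ((1 + r ^ 2 : ℝ) : ℂ) • (ContinuousLinearMap.adjoint T * T)
    - ((r ^ 2 : ℝ) : ℂ) • (1 : H →L[ℂ] H)

/-- The class `𝐂_α`: bounded invertible operators `T` with `α(T*, T) ≥ 0`. -/
def MemCAlpha [CompleteSpace H] (r : ℝ) (T : H →L[ℂ] H) : Prop :=
  IsUnit T ∧ (alphaOp r T).IsPositive

/-- The rational function `f` has no pole in `X` (`f.num` and `f.denom` are coprime, so that
the finite poles of `f` are exactly the zeros of `f.denom`). -/
def PolesOutside (X : Set ℂ) (f : RatFunc ℂ) : Prop :=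
  ∀ z ∈ X, f.denom.eval z ≠ 0

/-- The operator `f(T) = p(T) q(T)⁻¹` for a rational function `f = p / q` in lowest terms.
It is meaningful when no pole of `f` is in the spectrum of `T` (then `q(T)` is invertible). -/
def ratFuncOp (f : RatFunc ℂ) (T : H →L[ℂ] H) : H →L[ℂ] H :=
  Polynomial.aeval T f.num * Ring.inverse (Polynomial.aeval T f.denom)

/-- The bounded operator on the Hilbert space direct sum `Hⁿ = H ⊕ ⋯ ⊕ H` given by
an `n × n` matrix of bounded operators on `H`: `(A x) i = ∑ j, A i j (x j)`. -/
def blockOp {n : ℕ} (A : Matrix (Fin n) (Fin n) (H →L[ℂ] H)) :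
    PiLp 2 (fun _ : Fin n => H) →L[ℂ] PiLp 2 (fun _ : Fin n => H) :=
  ((PiLp.continuousLinearEquiv 2 ℂ (fun _ : Fin n => H)).symm :
      (Fin n → H) →L[ℂ] PiLp 2 (fun _ : Fin n => H)) ∘L
    ContinuousLinearMap.pi
      (fun i => ∑ j, (A i j) ∘L PiLp.proj 2 (fun _ : Fin n => H) j)

theorem blockOp_apply {n : ℕ} (A : Matrix (Fin n) (Fin n) (H →L[ℂ] H))
    (x : PiLp 2 (fun _ : Fin n => H)) (i : Fin n) :
    blockOp A x i = ∑ j, A i j (x j) := by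
  simp [blockOp]

/-- The norm `‖F(z)‖` of the value at `z` of a matrix of rational functions: the operator norm
of the complex matrix `(F i j)(z)` on the Euclidean space `ℂⁿ`. -/
def valueNorm {n : ℕ} (F : Matrix (Fin n) (Fin n) (RatFunc ℂ)) (z : ℂ) : ℝ :=
  ‖Matrix.toEuclideanCLM (n := Fin n) (𝕜 := ℂ) (F.map (RatFunc.eval (RingHom.id ℂ) z))‖

/-- The compact set `X` is a complete `K`-spectral set for `T`: the spectrum of `T` lies in `X`
and `‖F(T)‖ ≤ K max_{z ∈ X} ‖F(z)‖` for all `n` and all `n × n` matrices `F` of rational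
functions with poles outside `X`. -/
def IsCompleteSpectralSet (X : Set ℂ) (K : ℝ) (T : H →L[ℂ] H) : Prop :=
  spectrum ℂ T ⊆ X ∧
    ∀ (n : ℕ) (F : Matrix (Fin n) (Fin n) (RatFunc ℂ)),
      (∀ i j, PolesOutside X (F i j)) →
        ‖blockOp (F.map fun f => ratFuncOp f T)‖ ≤ K * sSup (valueNorm F '' X)

end AnnulusModel

end

open Metric Real
open scoped ComplexConjugate InnerProductSpace

noncomputable section

namespace AnnulusModel

/-! ### Circle averages: mean value property and Cauchy's theorem -/

section CircleAverage

/-! Suppose first that the spectrum of `T` lies inside `a < |z| < b` and that the form `Q = -T*²T² +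
(a²+b²)T*T - a²b²` equals `S* S`. Put `R(z) = z(z - T)⁻¹`, `P_b = T*T - a²` and `P_a = b² - T*T`, so
that `P_a + P_b = b² - a²`. On `|z| = c` one has `R*(c²X - T*XT)R = c²(R*X + XR - X)`, which is
linear in `R`; since `R` averages to `1` over the outer circle and to `0` over the inner one, `R*QR`
averages to `b² P_b` and `a² P_a` there. In particular `P_a, P_b ≥ 0`.

On each circle let the weight `W` be `c⁻² R(z) - d⁻² R(d²z/c²)`, where `c` is the radius of that
circle and `d` that of the other; `d²z/c²` is the reflection of `z` in the other circle. If `f(z) -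
f(T) = (z - T)g(z)` with `g` holomorphic on the annulus, then the averages of `W* Q R f` over the
two circles add up to `(b² - a²) f(T)` (`SpectrumInAnnulus.representation`): the `f(T)` parts give
`P_b + P_a`, and the `g` parts cancel by Cauchy's theorem because reflection makes `R*` holomorphic.

Pair this with `X` and `Y = f(T)X`, factor `Q = S* S`, and apply Cauchy–Schwarz and the
arithmetic–geometric mean inequality. The `R` terms sum to `M²(b² - a²)‖X‖²`, and each weight term
is at most `(b² - a²)‖Y‖²/4` (`circleWeight_outer_le`, `circleWeight_inner_le`). Hence `‖Y‖² ≤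
‖Y‖²/2 + M²‖X‖²`, which is the constant `√2`.

Only commutation of the values of `f` with `T` and `S` is used, so the argument applies on `Hⁿ` to
diagonal `T`, `S` and scalar matrices `F(z)`. The closed annulus is reached by taking `a = r/ρ`, `b
= ρ` with `ρ > 1` close to `1`, which keeps `Q ≥ 0` (`hereditaryForm_nonneg`). -/

theorem circleAverage_eq_apply_zero {E : Type*} [NormedAddCommGroup E] [NormedSpace ℂ E]
    [CompleteSpace E] {f : ℂ → E} {c : ℝ} (hc : 0 < c)
    (hf : ∀ z : ℂ, ‖z‖ ≤ c → DifferentiableAt ℂ f z) : circleAverage f 0 c = f 0 := by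
  apply DiffContOnCl.circleAverage
  apply DifferentiableOn.diffContOnCl
  intro z hz
  rw [abs_of_pos hc, closure_ball _ hc.ne'] at hz
  exact (hf z (by simpa using hz)).differentiableWithinAt

theorem circleAverage_eq_of_differentiable_annulus {E : Type*} [NormedAddCommGroup E]
    [NormedSpace ℂ E] {f : ℂ → E} {a b : ℝ} (ha : 0 < a) (hab : a ≤ b)
    (hf : ∀ z : ℂ, a ≤ ‖z‖ → ‖z‖ ≤ b → DifferentiableAt ℂ f z) :
    circleAverage f 0 a = circleAverage f 0 b := by
  rw [circleAverage_eq_circleIntegral ha.ne', circleAverage_eq_circleIntegral (ha.trans_le hab).ne']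
  congr 1
  refine (Complex.circleIntegral_sub_center_inv_smul_eq_of_differentiable_on_annulus_off_countable
    ha hab Set.countable_empty ?_ ?_).symm
  · intro z hz
    simp only [Set.mem_sdiff, mem_closedBall, dist_zero_right, mem_ball, not_lt] at hz
    exact (hf z hz.2 hz.1).continuousAt.continuousWithinAt
  · intro z hz
    simp only [Set.mem_sdiff, mem_closedBall, dist_zero_right, mem_ball, not_le,
      Set.mem_empty_iff_false, not_false_eq_true, and_true] at hz
    exact hf z hz.2.le hz.1.le

theorem circleAverage_comp_mul {E : Type*} [NormedAddCommGroup E] [NormedSpace ℝ E]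
    (f : ℂ → E) (k c : ℝ) : circleAverage (fun z => f ((k : ℂ) * z)) 0 c = circleAverage f 0 (k * c) := by
  simp only [circleAverage, circleMap_zero, Complex.ofReal_mul, mul_assoc]

theorem circleAverage_congr_norm {E : Type*} [NormedAddCommGroup E] [NormedSpace ℝ E]
    {f g : ℂ → E} {c : ℝ} (hc : 0 < c) (h : ∀ z : ℂ, ‖z‖ = c → f z = g z) :
    circleAverage f 0 c = circleAverage g 0 c := by
  apply circleAverage_congr_sphere
  intro z hz
  exact h z (by simpa [abs_of_pos hc] using hz)

theorem circleIntegrable_of_continuousAt {E : Type*} [NormedAddCommGroup E]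
    {f : ℂ → E} {c : ℝ} (hc : 0 < c) (h : ∀ z : ℂ, ‖z‖ = c → ContinuousAt f z) :
    CircleIntegrable f 0 c := by
  apply ContinuousOn.circleIntegrable hc.le
  intro z hz
  exact (h z (by simpa using hz)).continuousWithinAt

end CircleAverage

/-! ### The scaled resolvent and its reflection in a circle -/

section Algebra

variable {A : Type*} [CStarAlgebra A]

theorem circleAverage_mul_mul {f : ℂ → A} {c : ℝ} (hf : CircleIntegrable f 0 c) (X Y : A) :
    circleAverage (fun z => X * f z * Y) 0 c = X * circleAverage f 0 c * Y :=
  ((ContinuousLinearMap.mulLeftRight ℂ A X Y).restrictScalars ℝ).circleAverage_comp_comm hf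

theorem circleAverage_star {f : ℂ → A} {c : ℝ} (hf : CircleIntegrable f 0 c) :
    circleAverage (fun z => star (f z)) 0 c = star (circleAverage f 0 c) :=
  ((starL' ℝ : A ≃L[ℝ] A) : A →L[ℝ] A).circleAverage_comp_comm hf

/-- The function `z ↦ z (z - T)⁻¹`. -/
def scaledResolvent (T : A) (z : ℂ) : A := z • resolvent T z

/-- The function `z ↦ (1 - (z / c²) T*)⁻¹`, the adjoint of the scaled resolvent at the reflection
of `z` in the circle of radius `c`. -/
def reflectedResolvent (T : A) (c : ℝ) (z : ℂ) : A :=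
  Ring.inverse (1 - (z / (c : ℂ) ^ 2) • star T)

@[simp] theorem scaledResolvent_zero (T : A) : scaledResolvent T 0 = 0 := by
  simp [scaledResolvent]

@[simp] theorem reflectedResolvent_zero (T : A) (c : ℝ) : reflectedResolvent T c 0 = 1 := by
  simp [reflectedResolvent]

theorem differentiableAt_scaledResolvent {T : A} {z : ℂ}
    (h : IsUnit (algebraMap ℂ A z - T)) : DifferentiableAt ℂ (scaledResolvent T) z :=
  differentiableAt_id.smul
    (spectrum.hasDerivAt_resolvent_const_left (by simpa [spectrum.mem_resolventSet_iff] using h)).differentiableAt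

theorem mul_scaledResolvent {T : A} {z : ℂ} (h : IsUnit (algebraMap ℂ A z - T)) :
    T * scaledResolvent T z = z • (scaledResolvent T z - 1) := by
  have h1 : (algebraMap ℂ A z - T) * resolvent T z = 1 := Ring.mul_inverse_cancel _ h
  rw [sub_mul, Algebra.algebraMap_eq_smul_one, smul_mul_assoc, one_mul] at h1
  rw [scaledResolvent, mul_smul_comm, ← h1]
  congr 1
  abel

theorem scaledResolvent_mul {T : A} {z : ℂ} (h : IsUnit (algebraMap ℂ A z - T)) :
    scaledResolvent T z * (algebraMap ℂ A z - T) = z • 1 := by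
  rw [scaledResolvent, smul_mul_assoc, resolvent, Ring.inverse_mul_cancel _ h]

/-- Since `T R = z (R - 1)` and `conj z * z = c²`, the quadratic terms `R* X R` cancel. What remains
is linear in `R` and `R*`, so its circle average needs only the average of `R`. -/
theorem star_scaledResolvent_mul_mul {T : A} {z : ℂ} (h : IsUnit (algebraMap ℂ A z - T)) (X : A)
    {c : ℝ} (hc : ‖z‖ = c) :
    star (scaledResolvent T z) * (((c ^ 2 : ℝ) : ℂ) • X - star T * X * T) * scaledResolvent T z =
      ((c ^ 2 : ℝ) : ℂ) • (star (scaledResolvent T z) * X + X * scaledResolvent T z - X) := by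
  set R := scaledResolvent T z with hR
  have h1 : T * R = z • (R - 1) := mul_scaledResolvent h
  have h2 : star R * star T = conj z • (star R - 1) := by
    rw [← star_mul, h1]; simp
  have h3 : conj z * z = ((c ^ 2 : ℝ) : ℂ) := by
    rw [mul_comm, Complex.mul_conj, Complex.normSq_eq_norm_sq, hc]
  calc star R * (((c ^ 2 : ℝ) : ℂ) • X - star T * X * T) * R
      = ((c ^ 2 : ℝ) : ℂ) • (star R * X * R) - (star R * star T) * X * (T * R) := by
        simp only [mul_sub, sub_mul, mul_smul_comm, smul_mul_assoc, mul_assoc]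
    _ = ((c ^ 2 : ℝ) : ℂ) • (star R * X * R) - (conj z * z) • ((star R - 1) * X * (R - 1)) := by
        rw [h1, h2]; simp only [mul_smul_comm, smul_mul_assoc, smul_smul, mul_comm]
    _ = _ := by
        rw [h3, ← smul_sub]; congr 1; noncomm_ring

theorem isUnit_one_sub_smul_star {T : A} {w : ℂ} (hw : w ≠ 0)
    (h : IsUnit (algebraMap ℂ A w - T)) : IsUnit (1 - (conj w)⁻¹ • star T) := by
  have h1 : 1 - (conj w)⁻¹ • star T = (conj w)⁻¹ • star (algebraMap ℂ A w - T) := by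
    have : conj w ≠ 0 := by simpa using hw
    rw [star_sub, Algebra.algebraMap_eq_smul_one, star_smul, star_one, smul_sub, smul_smul]
    simp [this]
  rw [h1]
  have h2 : IsUnit ((Units.mk0 ((conj w)⁻¹) (by simpa using hw)) • star (algebraMap ℂ A w - T)) :=
    (isUnit_smul_iff _ _).2 h.star
  exact h2

theorem star_scaledResolvent {T : A} {w : ℂ} (hw : w ≠ 0)
    (h : IsUnit (algebraMap ℂ A w - T)) :
    star (scaledResolvent T w) = Ring.inverse (1 - (conj w)⁻¹ • star T) := by
  have hw' : conj w ≠ 0 := by simpa using hw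
  have hu := isUnit_one_sub_smul_star hw h
  have h1 : star (scaledResolvent T w) * (1 - (conj w)⁻¹ • star T) = 1 := by
    have h2 := congrArg star (mul_scaledResolvent h)
    rw [star_mul] at h2
    rw [mul_sub, mul_smul_comm, h2, star_smul, smul_smul]
    simp [hw']
  exact left_inv_eq_right_inv h1 (Ring.mul_inverse_cancel _ hu)

/-- The points `w` and `z` are reflections of each other in the circle of radius `c`. Reflection and
adjoint are both antiholomorphic, so their composite depends holomorphically on `z`; this is what
makes Cauchy's theorem available for adjoints. -/
theorem star_scaledResolvent_eq_reflectedResolvent {T : A} {w z : ℂ} {c : ℝ} (hc : 0 < c)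
    (hwz : z * conj w = (c : ℂ) ^ 2) (h : IsUnit (algebraMap ℂ A w - T)) :
    star (scaledResolvent T w) = reflectedResolvent T c z := by
  have hc' : (c : ℂ) ^ 2 ≠ 0 := by simpa using hc.ne'
  have hw' : conj w ≠ 0 := fun h0 => hc' (by rw [← hwz, h0, mul_zero])
  have hw : w ≠ 0 := by simpa using hw'
  have hz : z ≠ 0 := fun h0 => hc' (by rw [← hwz, h0, zero_mul])
  rw [star_scaledResolvent hw h, reflectedResolvent, ← hwz]
  congr 3
  field_simp

theorem differentiableAt_reflectedResolvent {T : A} {c : ℝ} {z : ℂ}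
    (h : IsUnit (1 - (z / (c : ℂ) ^ 2) • star T)) :
    DifferentiableAt ℂ (reflectedResolvent T c) z := by
  have h1 : DifferentiableAt ℂ (fun z : ℂ => 1 - (z / (c : ℂ) ^ 2) • star T) z := by fun_prop
  exact (differentiableAt_inverse h).comp z h1

theorem isUnit_reflected {T : A} {c : ℝ} (hc : 0 < c) {z : ℂ}
    (h : ∀ w : ℂ, z * conj w = (c : ℂ) ^ 2 → IsUnit (algebraMap ℂ A w - T)) :
    IsUnit (1 - (z / (c : ℂ) ^ 2) • star T) := by
  rcases eq_or_ne z 0 with rfl | hz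
  · simp
  have hc' : (c : ℂ) ^ 2 ≠ 0 := by simpa using hc.ne'
  have hw : conj ((c : ℂ) ^ 2 / conj z) = (c : ℂ) ^ 2 / z := by simp
  have := isUnit_one_sub_smul_star (T := T) (w := (c : ℂ) ^ 2 / conj z)
    (div_ne_zero hc' (by simpa using hz)) (h _ (by rw [hw]; field_simp))
  rwa [hw, inv_div] at this

theorem norm_mul_eq_of_mul_conj {z w : ℂ} {c : ℝ} (h : z * conj w = (c : ℂ) ^ 2) :
    ‖z‖ * ‖w‖ = c ^ 2 := by
  have := congrArg norm h
  simpa using this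

end Algebra

/-! ### Averages of the resolvent and of cross terms -/

section Averages

variable {A : Type*} [CStarAlgebra A] {T : A} {a b : ℝ}

theorem continuousAt_scaledResolvent {z : ℂ} (h : IsUnit (algebraMap ℂ A z - T)) :
    ContinuousAt (scaledResolvent T) z :=
  (differentiableAt_scaledResolvent h).continuousAt

theorem circleAverage_scaledResolvent_inner (hin : ∀ z : ℂ, ‖z‖ ≤ a → IsUnit (algebraMap ℂ A z - T))
    {c : ℝ} (hc : 0 < c) (hca : c ≤ a) : circleAverage (scaledResolvent T) 0 c = 0 := by
  rw [circleAverage_eq_apply_zero hc, scaledResolvent_zero]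
  exact fun z hz => differentiableAt_scaledResolvent (hin z (hz.trans hca))

theorem isUnit_reflected_of_norm_le (hb : 0 < b)
    (hout : ∀ z : ℂ, b ≤ ‖z‖ → IsUnit (algebraMap ℂ A z - T))
    {c : ℝ} (hbc : b ≤ c) {z : ℂ} (hz : ‖z‖ ≤ c) :
    IsUnit (1 - (z / (c : ℂ) ^ 2) • star T) := by
  apply isUnit_reflected (hb.trans_le hbc)
  intro w hw
  have h1 := norm_mul_eq_of_mul_conj hw
  apply hout
  by_contra! h
  have hc : 0 < c := hb.trans_le hbc
  nlinarith [norm_nonneg z, norm_nonneg w]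

theorem isUnit_reflected_of_le_norm (ha : 0 < a)
    (hin : ∀ z : ℂ, ‖z‖ ≤ a → IsUnit (algebraMap ℂ A z - T)) {z : ℂ} (hz : a ≤ ‖z‖) :
    IsUnit (1 - (z / (a : ℂ) ^ 2) • star T) := by
  apply isUnit_reflected ha
  intro w hw
  have h1 := norm_mul_eq_of_mul_conj hw
  apply hin
  by_contra! h
  nlinarith [norm_nonneg z, norm_nonneg w]

theorem mul_conj_real_mul {k c d : ℝ} {z : ℂ} (hz : ‖z‖ = c) (h : k * c ^ 2 = d ^ 2) :
    z * conj ((k : ℂ) * z) = (d : ℂ) ^ 2 := by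
  rw [map_mul, Complex.conj_ofReal, mul_left_comm, Complex.mul_conj, Complex.normSq_eq_norm_sq, hz]
  exact_mod_cast h

theorem norm_real_mul {k c : ℝ} {z : ℂ} (hk : 0 ≤ k) (hz : ‖z‖ = c) : ‖(k : ℂ) * z‖ = k * c := by
  rw [norm_mul, hz, Complex.norm_real, Real.norm_of_nonneg hk]

/-- After taking adjoints, the integrand agrees on the circle with the reflected resolvent, which is
holomorphic on the whole disc with value `1` at the centre. No expansion at infinity is needed. -/
theorem circleAverage_scaledResolvent_outer (hb : 0 < b)
    (hout : ∀ z : ℂ, b ≤ ‖z‖ → IsUnit (algebraMap ℂ A z - T))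
    {c : ℝ} (hbc : b ≤ c) : circleAverage (scaledResolvent T) 0 c = 1 := by
  have hc : 0 < c := hb.trans_le hbc
  apply star_injective
  rw [← circleAverage_star, star_one]
  · rw [circleAverage_congr_norm (g := reflectedResolvent T c) hc, circleAverage_eq_apply_zero hc,
      reflectedResolvent_zero]
    · exact fun z hz => differentiableAt_reflectedResolvent
        (isUnit_reflected_of_norm_le hb hout hbc hz)
    · intro z hz
      apply star_scaledResolvent_eq_reflectedResolvent hc _ (hout z (by rw [hz]; exact hbc))
      simpa using mul_conj_real_mul (k := 1) hz (one_mul _)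
  · exact circleIntegrable_of_continuousAt hc fun z hz =>
      continuousAt_scaledResolvent (hout z (by rw [hz]; exact hbc))

/-- Both factors are holomorphic on the disc and the second vanishes at `0`, so the mean value
property gives zero. This kills the cross terms between `R` at a point and `R` at its reflection. -/
theorem circleAverage_reflectedResolvent_mul_scaledResolvent (hb : 0 < b)
    (hin : ∀ z : ℂ, ‖z‖ ≤ a → IsUnit (algebraMap ℂ A z - T))
    (hout : ∀ z : ℂ, b ≤ ‖z‖ → IsUnit (algebraMap ℂ A z - T)) (X : A)
    {c k : ℝ} (hc : 0 < c) (hcb : c ≤ b) (hk : 0 ≤ k) (hkc : k * c ≤ a) :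
    circleAverage (fun z => reflectedResolvent T b z * X * scaledResolvent T ((k : ℂ) * z)) 0 c
      = 0 := by
  rw [circleAverage_eq_apply_zero hc]
  · simp
  · intro z hz
    have h1 := differentiableAt_reflectedResolvent
      (isUnit_reflected_of_norm_le hb hout le_rfl (hz.trans hcb))
    have h2 : DifferentiableAt ℂ (scaledResolvent T) ((k : ℂ) * z) := by
      apply differentiableAt_scaledResolvent (hin _ _)
      rw [norm_real_mul hk rfl]
      exact (mul_le_mul_of_nonneg_left hz hk).trans hkc
    have h3 : DifferentiableAt ℂ (fun z : ℂ => scaledResolvent T ((k : ℂ) * z)) z :=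
      h2.comp z (by fun_prop)
    exact (h1.mul_const X).mul h3

theorem circleAverage_star_mul_mul {c : ℝ} (hc : 0 < c)
    (h : ∀ z : ℂ, ‖z‖ = c → IsUnit (algebraMap ℂ A z - T)) (X : A) :
    circleAverage (fun z => star (scaledResolvent T z) *
      (((c ^ 2 : ℝ) : ℂ) • X - star T * X * T) * scaledResolvent T z) 0 c =
    ((c ^ 2 : ℝ) : ℂ) • (star (circleAverage (scaledResolvent T) 0 c) * X +
      X * circleAverage (scaledResolvent T) 0 c - X) := by
  have hi : CircleIntegrable (scaledResolvent T) 0 c :=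
    circleIntegrable_of_continuousAt hc fun z hz => continuousAt_scaledResolvent (h z hz)
  have hs : CircleIntegrable (fun z => star (scaledResolvent T z)) 0 c :=
    circleIntegrable_of_continuousAt hc fun z hz => (continuousAt_scaledResolvent (h z hz)).star
  have h1 : CircleIntegrable (fun z => star (scaledResolvent T z) * X) 0 c :=
    circleIntegrable_of_continuousAt hc fun z hz =>
      (continuousAt_scaledResolvent (h z hz)).star.mul continuousAt_const
  have h2 : CircleIntegrable (fun z => X * scaledResolvent T z) 0 c :=
    circleIntegrable_of_continuousAt hc fun z hz =>
      continuousAt_const.mul (continuousAt_scaledResolvent (h z hz))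
  have h3 : CircleIntegrable (fun z => star (scaledResolvent T z) * X + X * scaledResolvent T z)
    0 c := h1.add h2
  rw [circleAverage_congr_norm hc fun z hz => star_scaledResolvent_mul_mul (h z hz) X hz,
    circleAverage_fun_smul, circleAverage_fun_sub h3 (circleIntegrable_const _ _ _),
    circleAverage_fun_add h1 h2, circleAverage_const]
  have e1 := circleAverage_mul_mul hs 1 X
  have e2 := circleAverage_mul_mul hi X 1
  simp only [one_mul, mul_one] at e1 e2
  rw [e1, e2, circleAverage_star hi]

end Averages

/-! ### The hereditary form and its averages over the two boundary circles -/

/-- The hereditary expression `-T*² T² + (a² + b²) T* T - a² b²`. -/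
def hereditaryForm {A : Type*} [CStarAlgebra A] (a b : ℝ) (T : A) : A :=
  -(star T ^ 2 * T ^ 2) + ((a ^ 2 + b ^ 2 : ℝ) : ℂ) • (star T * T)
    - ((a ^ 2 * b ^ 2 : ℝ) : ℂ) • 1

/-- The hypotheses of the annulus estimate, with radii `a < b`. -/
structure SpectrumInAnnulus {A : Type*} [CStarAlgebra A] (a b : ℝ) (T : A) : Prop where
  pos : 0 < a
  lt : a < b
  inner : ∀ z : ℂ, ‖z‖ ≤ a → IsUnit (algebraMap ℂ A z - T)
  outer : ∀ z : ℂ, b ≤ ‖z‖ → IsUnit (algebraMap ℂ A z - T)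

section Form

variable {A : Type*} [CStarAlgebra A] {T : A} {a b : ℝ}

/-- This is the factorization `(b² - t)(t - a²)` read hereditarily, peeling off the factor `b² - t`.
It has the shape `b² X - T* X T` needed for averaging over the outer circle; the other order of the
factors serves the inner circle. -/
theorem hereditaryForm_eq_outer : hereditaryForm a b T =
    ((b ^ 2 : ℝ) : ℂ) • (star T * T - ((a ^ 2 : ℝ) : ℂ) • 1)
      - star T * (star T * T - ((a ^ 2 : ℝ) : ℂ) • 1) * T := by
  simp only [hereditaryForm, mul_sub, sub_mul, smul_sub, mul_smul_comm, smul_mul_assoc, mul_one,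
    smul_smul, Complex.ofReal_add, add_smul, Complex.ofReal_mul, pow_two, mul_assoc]
  rw [show (b : ℂ) * (b * (a * a)) = a * (a * (b * b)) by ring]
  abel

theorem hereditaryForm_eq_inner : hereditaryForm a b T =
    star T * (((b ^ 2 : ℝ) : ℂ) • 1 - star T * T) * T
      - ((a ^ 2 : ℝ) : ℂ) • (((b ^ 2 : ℝ) : ℂ) • 1 - star T * T) := by
  simp only [hereditaryForm, mul_sub, sub_mul, smul_sub, mul_smul_comm, smul_mul_assoc, mul_one,
    smul_smul, Complex.ofReal_add, add_smul, Complex.ofReal_mul, pow_two, mul_assoc]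
  abel

theorem SpectrumInAnnulus.pos' (h : SpectrumInAnnulus a b T) : 0 < b := h.pos.trans h.lt

theorem SpectrumInAnnulus.circleAverage_outer (h : SpectrumInAnnulus a b T) :
    circleAverage (fun z => star (scaledResolvent T z) * hereditaryForm a b T *
      scaledResolvent T z) 0 b = ((b ^ 2 : ℝ) : ℂ) • (star T * T - ((a ^ 2 : ℝ) : ℂ) • 1) := by
  rw [hereditaryForm_eq_outer, circleAverage_star_mul_mul h.pos' fun z hz => h.outer z hz.ge,
    circleAverage_scaledResolvent_outer h.pos' h.outer le_rfl]
  simp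

theorem SpectrumInAnnulus.circleAverage_inner (h : SpectrumInAnnulus a b T) :
    circleAverage (fun z => star (scaledResolvent T z) * hereditaryForm a b T *
      scaledResolvent T z) 0 a = ((a ^ 2 : ℝ) : ℂ) • (((b ^ 2 : ℝ) : ℂ) • 1 - star T * T) := by
  have e : hereditaryForm a b T =
      ((a ^ 2 : ℝ) : ℂ) • (star T * T - ((b ^ 2 : ℝ) : ℂ) • 1)
      - star T * (star T * T - ((b ^ 2 : ℝ) : ℂ) • 1) * T := by
    rw [hereditaryForm_eq_inner, ← neg_sub (star T * T)]
    simp only [mul_neg, neg_mul, smul_neg]; abel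
  rw [e, circleAverage_star_mul_mul h.pos fun z hz => h.inner z hz.le,
    circleAverage_scaledResolvent_inner h.inner h.pos le_rfl]
  simp

end Form

/-! ### A two-circle integral representation of `f(T)` -/

section Representation

variable {A : Type*} [CStarAlgebra A] {T : A} {a b : ℝ}

/-- Substituting `Φ = B + (z - T) G` gives `R Φ = R B + z G`: the resolvent singularity stays only
with the constant `B`. -/
theorem circleAverage_mul_scaledResolvent_mul {c : ℝ} (hc : 0 < c) {V Φ G : ℂ → A} {B X : A}
    (hu : ∀ z : ℂ, ‖z‖ = c → IsUnit (algebraMap ℂ A z - T))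
    (hV : ∀ z : ℂ, ‖z‖ = c → ContinuousAt V z) (hG : ∀ z : ℂ, ‖z‖ = c → ContinuousAt G z)
    (hΦ : ∀ z : ℂ, ‖z‖ = c → (algebraMap ℂ A z - T) * G z = Φ z - B) :
    circleAverage (fun z => V z * X * (scaledResolvent T z * Φ z)) 0 c =
      circleAverage (fun z => V z * X * scaledResolvent T z) 0 c * B +
        circleAverage (fun z => V z * X * (z • G z)) 0 c := by
  have h1 : CircleIntegrable (fun z => V z * X * scaledResolvent T z) 0 c :=
    circleIntegrable_of_continuousAt hc fun z hz =>
      ((hV z hz).mul continuousAt_const).mul (continuousAt_scaledResolvent (hu z hz))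
  have h1' : CircleIntegrable (fun z => V z * X * scaledResolvent T z * B) 0 c :=
    circleIntegrable_of_continuousAt hc fun z hz =>
      (((hV z hz).mul continuousAt_const).mul (continuousAt_scaledResolvent (hu z hz))).mul
        continuousAt_const
  have h2 : CircleIntegrable (fun z => V z * X * (z • G z)) 0 c :=
    circleIntegrable_of_continuousAt hc fun z hz =>
      ((hV z hz).mul continuousAt_const).mul (continuousAt_id.smul (hG z hz))
  have e := circleAverage_mul_mul h1 1 B
  simp only [one_mul] at e
  rw [← e, ← circleAverage_fun_add h1' h2]
  refine circleAverage_congr_norm hc fun z hz => ?_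
  have h3 : scaledResolvent T z * Φ z = scaledResolvent T z * B + z • G z := by
    rw [← sub_eq_iff_eq_add', ← mul_sub, ← hΦ z hz, ← mul_assoc, scaledResolvent_mul (hu z hz),
      smul_mul_assoc, one_mul]
  rw [h3, mul_add, ← mul_assoc]

/-- The weight on the circle of radius `c` which pairs with the circle of radius `d`. -/
def circleWeight (T : A) (c d : ℝ) (z : ℂ) : A :=
  ((c ^ 2 : ℝ) : ℂ)⁻¹ • scaledResolvent T z -
    ((d ^ 2 : ℝ) : ℂ)⁻¹ • scaledResolvent T (((d ^ 2 / c ^ 2 : ℝ) : ℂ) * z)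

namespace SpectrumInAnnulus

theorem isUnit_outer (h : SpectrumInAnnulus a b T) {z : ℂ} (hz : ‖z‖ = b) :
    IsUnit (algebraMap ℂ A z - T) := h.outer z hz.ge

theorem isUnit_inner (h : SpectrumInAnnulus a b T) {z : ℂ} (hz : ‖z‖ = a) :
    IsUnit (algebraMap ℂ A z - T) := h.inner z hz.le

theorem isUnit_outer_scaled (h : SpectrumInAnnulus a b T) {z : ℂ} (hz : ‖z‖ = b) :
    IsUnit (algebraMap ℂ A (((a ^ 2 / b ^ 2 : ℝ) : ℂ) * z) - T) := by
  have ha := h.pos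
  have hb := h.pos'
  apply h.inner
  rw [norm_real_mul (by positivity) hz]
  have : a ^ 2 / b ^ 2 * b = a * (a / b) := by field_simp
  rw [this]
  exact mul_le_of_le_one_right ha.le ((div_le_one hb).2 h.lt.le)

theorem isUnit_inner_scaled (h : SpectrumInAnnulus a b T) {z : ℂ} (hz : ‖z‖ = a) :
    IsUnit (algebraMap ℂ A (((b ^ 2 / a ^ 2 : ℝ) : ℂ) * z) - T) := by
  have ha := h.pos
  have hb := h.pos'
  apply h.outer
  rw [norm_real_mul (by positivity) hz]
  have : b ^ 2 / a ^ 2 * a = b * (b / a) := by field_simp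
  rw [this]
  exact le_mul_of_one_le_right hb.le ((one_le_div ha).2 h.lt.le)

theorem continuousAt_outer (h : SpectrumInAnnulus a b T) {z : ℂ} (hz : ‖z‖ = b) :
    ContinuousAt (scaledResolvent T) z := continuousAt_scaledResolvent (h.isUnit_outer hz)

theorem continuousAt_inner (h : SpectrumInAnnulus a b T) {z : ℂ} (hz : ‖z‖ = a) :
    ContinuousAt (scaledResolvent T) z := continuousAt_scaledResolvent (h.isUnit_inner hz)

theorem continuousAt_outer_scaled (h : SpectrumInAnnulus a b T) {z : ℂ} (hz : ‖z‖ = b) :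
    ContinuousAt (fun z : ℂ => scaledResolvent T (((a ^ 2 / b ^ 2 : ℝ) : ℂ) * z)) z :=
  ContinuousAt.comp (g := scaledResolvent T) (continuousAt_scaledResolvent (h.isUnit_outer_scaled hz))
    (by fun_prop)

theorem continuousAt_inner_scaled (h : SpectrumInAnnulus a b T) {z : ℂ} (hz : ‖z‖ = a) :
    ContinuousAt (fun z : ℂ => scaledResolvent T (((b ^ 2 / a ^ 2 : ℝ) : ℂ) * z)) z :=
  ContinuousAt.comp (g := scaledResolvent T) (continuousAt_scaledResolvent (h.isUnit_inner_scaled hz))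
    (by fun_prop)

theorem star_outer (h : SpectrumInAnnulus a b T) {z : ℂ} (hz : ‖z‖ = b) :
    star (scaledResolvent T z) = reflectedResolvent T b z := by
  apply star_scaledResolvent_eq_reflectedResolvent h.pos' _ (h.isUnit_outer hz)
  simpa using mul_conj_real_mul (k := 1) hz (one_mul _)

theorem star_inner (h : SpectrumInAnnulus a b T) {z : ℂ} (hz : ‖z‖ = a) :
    star (scaledResolvent T z) = reflectedResolvent T a z := by
  apply star_scaledResolvent_eq_reflectedResolvent h.pos _ (h.isUnit_inner hz)
  simpa using mul_conj_real_mul (k := 1) hz (one_mul _)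

theorem star_outer_scaled (h : SpectrumInAnnulus a b T) {z : ℂ} (hz : ‖z‖ = b) :
    star (scaledResolvent T (((a ^ 2 / b ^ 2 : ℝ) : ℂ) * z)) = reflectedResolvent T a z := by
  apply star_scaledResolvent_eq_reflectedResolvent h.pos _ (h.isUnit_outer_scaled hz)
  have hb := h.pos'
  exact mul_conj_real_mul hz (by field_simp)

theorem star_inner_scaled (h : SpectrumInAnnulus a b T) {z : ℂ} (hz : ‖z‖ = a) :
    star (scaledResolvent T (((b ^ 2 / a ^ 2 : ℝ) : ℂ) * z)) = reflectedResolvent T b z := by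
  apply star_scaledResolvent_eq_reflectedResolvent h.pos' _ (h.isUnit_inner_scaled hz)
  have ha := h.pos
  exact mul_conj_real_mul hz (by field_simp)

theorem circleAverage_inner_cross (h : SpectrumInAnnulus a b T) (X : A) :
    circleAverage (fun z => star (scaledResolvent T (((b ^ 2 / a ^ 2 : ℝ) : ℂ) * z)) * X *
      scaledResolvent T z) 0 a = 0 := by
  have := circleAverage_reflectedResolvent_mul_scaledResolvent h.pos' h.inner h.outer X
    (c := a) (k := 1) h.pos h.lt.le zero_le_one (by simp)
  rw [← this]
  refine circleAverage_congr_norm h.pos fun z hz => ?_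
  rw [h.star_inner_scaled hz]
  simp

theorem circleAverage_inner_cross' (h : SpectrumInAnnulus a b T) (X : A) :
    circleAverage (fun z => star (scaledResolvent T z) * X *
      scaledResolvent T (((b ^ 2 / a ^ 2 : ℝ) : ℂ) * z)) 0 a = 0 := by
  apply star_injective
  rw [← circleAverage_star]
  · simp only [star_mul, star_star, star_zero, ← mul_assoc]
    exact h.circleAverage_inner_cross (star X)
  · exact circleIntegrable_of_continuousAt h.pos fun z hz =>
      ((h.continuousAt_inner hz).star.mul continuousAt_const).mul (h.continuousAt_inner_scaled hz)

theorem circleAverage_outer_cross' (h : SpectrumInAnnulus a b T) (X : A) :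
    circleAverage (fun z => star (scaledResolvent T z) * X *
      scaledResolvent T (((a ^ 2 / b ^ 2 : ℝ) : ℂ) * z)) 0 b = 0 := by
  have ha := h.pos
  have hb := h.pos'
  have := circleAverage_reflectedResolvent_mul_scaledResolvent h.pos' h.inner h.outer X
    (c := b) (k := a ^ 2 / b ^ 2) hb le_rfl (by positivity) (by
      have : a ^ 2 / b ^ 2 * b = a * (a / b) := by field_simp
      rw [this]
      exact mul_le_of_le_one_right ha.le ((div_le_one hb).2 h.lt.le))
  rw [← this]
  refine circleAverage_congr_norm hb fun z hz => ?_
  rw [h.star_outer hz]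

theorem circleAverage_outer_cross (h : SpectrumInAnnulus a b T) (X : A) :
    circleAverage (fun z => star (scaledResolvent T (((a ^ 2 / b ^ 2 : ℝ) : ℂ) * z)) * X *
      scaledResolvent T z) 0 b = 0 := by
  apply star_injective
  rw [← circleAverage_star]
  · simp only [star_mul, star_star, star_zero, ← mul_assoc]
    exact h.circleAverage_outer_cross' (star X)
  · exact circleIntegrable_of_continuousAt h.pos' fun z hz =>
      ((h.continuousAt_outer_scaled hz).star.mul continuousAt_const).mul (h.continuousAt_outer hz)

/-- Both integrands are boundary values of one function, `reflectedResolvent T b z * X * (z • G z)`,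
holomorphic on the closed annulus; Cauchy's theorem equates the two averages. -/
theorem circleAverage_annulus_outer (h : SpectrumInAnnulus a b T) {G : ℂ → A}
    (hG : ∀ z : ℂ, a ≤ ‖z‖ → ‖z‖ ≤ b → DifferentiableAt ℂ G z) (X : A) :
    circleAverage (fun z => star (scaledResolvent T (((b ^ 2 / a ^ 2 : ℝ) : ℂ) * z)) * X *
      (z • G z)) 0 a =
    circleAverage (fun z => star (scaledResolvent T z) * X * (z • G z)) 0 b := by
  rw [circleAverage_congr_norm (g := fun z => reflectedResolvent T b z * X * (z • G z)) h.pos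
      fun z hz => by rw [h.star_inner_scaled hz],
    circleAverage_congr_norm (g := fun z => reflectedResolvent T b z * X * (z • G z)) h.pos'
      fun z hz => by rw [h.star_outer hz]]
  refine circleAverage_eq_of_differentiable_annulus h.pos h.lt.le fun z h1 h2 => ?_
  exact ((differentiableAt_reflectedResolvent (isUnit_reflected_of_norm_le h.pos' h.outer le_rfl
    h2)).mul_const X).mul (differentiableAt_id.smul (hG z h1 h2))

theorem circleAverage_annulus_inner (h : SpectrumInAnnulus a b T) {G : ℂ → A}
    (hG : ∀ z : ℂ, a ≤ ‖z‖ → ‖z‖ ≤ b → DifferentiableAt ℂ G z) (X : A) :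
    circleAverage (fun z => star (scaledResolvent T z) * X * (z • G z)) 0 a =
    circleAverage (fun z => star (scaledResolvent T (((a ^ 2 / b ^ 2 : ℝ) : ℂ) * z)) * X *
      (z • G z)) 0 b := by
  rw [circleAverage_congr_norm (g := fun z => reflectedResolvent T a z * X * (z • G z)) h.pos
      fun z hz => by rw [h.star_inner hz],
    circleAverage_congr_norm (g := fun z => reflectedResolvent T a z * X * (z • G z)) h.pos'
      fun z hz => by rw [h.star_outer_scaled hz]]
  refine circleAverage_eq_of_differentiable_annulus h.pos h.lt.le fun z h1 h2 => ?_
  exact ((differentiableAt_reflectedResolvent (isUnit_reflected_of_le_norm h.pos h.inner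
    h1)).mul_const X).mul (differentiableAt_id.smul (hG z h1 h2))

theorem continuousAt_circleWeight_outer (h : SpectrumInAnnulus a b T) {z : ℂ} (hz : ‖z‖ = b) :
    ContinuousAt (circleWeight T b a) z :=
  ((h.continuousAt_outer hz).const_smul _).sub ((h.continuousAt_outer_scaled hz).const_smul _)

theorem continuousAt_circleWeight_inner (h : SpectrumInAnnulus a b T) {z : ℂ} (hz : ‖z‖ = a) :
    ContinuousAt (circleWeight T a b) z :=
  ((h.continuousAt_inner hz).const_smul _).sub ((h.continuousAt_inner_scaled hz).const_smul _)

end SpectrumInAnnulus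

theorem star_circleWeight_mul {c d : ℝ} {z : ℂ} (X : A) :
    star (circleWeight T c d z) * X = ((c ^ 2 : ℝ) : ℂ)⁻¹ • (star (scaledResolvent T z) * X) -
      ((d ^ 2 : ℝ) : ℂ)⁻¹ • (star (scaledResolvent T (((d ^ 2 / c ^ 2 : ℝ) : ℂ) * z)) * X) := by
  simp [circleWeight, sub_mul]

theorem circleAverage_smul_sub_smul {c : ℝ} {f g : ℂ → A} (hf : CircleIntegrable f 0 c)
    (hg : CircleIntegrable g 0 c) (s t : ℂ) :
    circleAverage (fun z => s • f z - t • g z) 0 c =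
      s • circleAverage f 0 c - t • circleAverage g 0 c := by
  have h1 : CircleIntegrable (fun z => s • f z) 0 c := IntervalIntegrable.smul hf s
  have h2 : CircleIntegrable (fun z => t • g z) 0 c := IntervalIntegrable.smul hg t
  rw [circleAverage_fun_sub h1 h2, circleAverage_fun_smul, circleAverage_fun_smul]

/-- The two terms of the weight carry coefficients `b⁻²` and `-a⁻²` on the outer circle and `a⁻²`
and `-b⁻²` on the inner one, so the `G` contributions, matched by Cauchy's theorem, cancel in pairs.
The cross terms multiplying `B` vanish, and the diagonal ones leave `(T*T - a²) + (b² - T*T)`. -/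
theorem SpectrumInAnnulus.representation (h : SpectrumInAnnulus a b T) {Φ G : ℂ → A} {B : A}
    (hG : ∀ z : ℂ, a ≤ ‖z‖ → ‖z‖ ≤ b → DifferentiableAt ℂ G z)
    (hΦ : ∀ z : ℂ, a ≤ ‖z‖ → ‖z‖ ≤ b → (algebraMap ℂ A z - T) * G z = Φ z - B)
    (hΦc : ∀ z : ℂ, a ≤ ‖z‖ → ‖z‖ ≤ b → ContinuousAt Φ z) :
    circleAverage (fun z => star (circleWeight T b a z) * hereditaryForm a b T *
        (scaledResolvent T z * Φ z)) 0 b +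
      circleAverage (fun z => star (circleWeight T a b z) * hereditaryForm a b T *
        (scaledResolvent T z * Φ z)) 0 a = ((b ^ 2 - a ^ 2 : ℝ) : ℂ) • B := by
  have ha := h.pos
  have hb := h.pos'
  have hGa : ∀ z : ℂ, ‖z‖ = a → ContinuousAt G z := fun z hz =>
    (hG z hz.ge (hz.trans_le h.lt.le)).continuousAt
  have hGb : ∀ z : ℂ, ‖z‖ = b → ContinuousAt G z := fun z hz =>
    (hG z (h.lt.le.trans_eq hz.symm) hz.le).continuousAt
  have hPa : ∀ z : ℂ, ‖z‖ = a → ContinuousAt (fun z => scaledResolvent T z * Φ z) z := fun z hz =>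
    (h.continuousAt_inner hz).mul (hΦc z hz.ge (hz.trans_le h.lt.le))
  have hPb : ∀ z : ℂ, ‖z‖ = b → ContinuousAt (fun z => scaledResolvent T z * Φ z) z := fun z hz =>
    (h.continuousAt_outer hz).mul (hΦc z (h.lt.le.trans_eq hz.symm) hz.le)
  have hΦa : ∀ z : ℂ, ‖z‖ = a → (algebraMap ℂ A z - T) * G z = Φ z - B := fun z hz =>
    hΦ z hz.ge (hz.trans_le h.lt.le)
  have hΦb : ∀ z : ℂ, ‖z‖ = b → (algebraMap ℂ A z - T) * G z = Φ z - B := fun z hz =>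
    hΦ z (h.lt.le.trans_eq hz.symm) hz.le
  simp only [star_circleWeight_mul, sub_mul, smul_mul_assoc]
  rw [circleAverage_smul_sub_smul, circleAverage_smul_sub_smul,
    circleAverage_mul_scaledResolvent_mul hb (fun z => h.isUnit_outer)
      (fun z hz => (h.continuousAt_outer hz).star) hGb hΦb,
    circleAverage_mul_scaledResolvent_mul hb (fun z => h.isUnit_outer)
      (fun z hz => (h.continuousAt_outer_scaled hz).star) hGb hΦb,
    circleAverage_mul_scaledResolvent_mul ha (fun z => h.isUnit_inner)
      (fun z hz => (h.continuousAt_inner hz).star) hGa hΦa,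
    circleAverage_mul_scaledResolvent_mul ha (fun z => h.isUnit_inner)
      (fun z hz => (h.continuousAt_inner_scaled hz).star) hGa hΦa,
    h.circleAverage_inner_cross, h.circleAverage_outer_cross, h.circleAverage_annulus_outer hG,
    h.circleAverage_annulus_inner hG, h.circleAverage_outer, h.circleAverage_inner]
  · have ha' : ((a ^ 2 : ℝ) : ℂ) ≠ 0 := by exact_mod_cast (by positivity : a ^ 2 ≠ 0)
    have hb' : ((b ^ 2 : ℝ) : ℂ) ≠ 0 := by exact_mod_cast (by positivity : b ^ 2 ≠ 0)
    simp only [smul_mul_assoc, sub_mul, zero_mul, zero_add, smul_add, smul_smul,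
      inv_mul_cancel₀ ha', inv_mul_cancel₀ hb', one_smul, one_mul, Complex.ofReal_sub, sub_smul]
    abel
  · exact circleIntegrable_of_continuousAt ha fun z hz =>
      ((h.continuousAt_inner hz).star.mul continuousAt_const).mul (hPa z hz)
  · exact circleIntegrable_of_continuousAt ha fun z hz =>
      ((h.continuousAt_inner_scaled hz).star.mul continuousAt_const).mul (hPa z hz)
  · exact circleIntegrable_of_continuousAt hb fun z hz =>
      ((h.continuousAt_outer hz).star.mul continuousAt_const).mul (hPb z hz)
  · exact circleIntegrable_of_continuousAt hb fun z hz =>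
      ((h.continuousAt_outer_scaled hz).star.mul continuousAt_const).mul (hPb z hz)

end Representation

/-! ### Positivity and averages of the form over other circles -/

section Estimate

variable {K : Type*} [NormedAddCommGroup K] [InnerProductSpace ℂ K] [CompleteSpace K]
  {T : K →L[ℂ] K} {a b : ℝ}

/-- The real functional `B ↦ Re ⟪Y, B X⟫`. -/
def reMatrixCoeff (Y X : K) : (K →L[ℂ] K) →L[ℝ] ℝ :=
  Complex.reCLM.comp (((innerSL ℂ Y).comp (ContinuousLinearMap.apply ℂ K X)).restrictScalars ℝ)

omit [CompleteSpace K] in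
theorem reMatrixCoeff_apply (Y X : K) (B : K →L[ℂ] K) :
    reMatrixCoeff Y X B = (⟪Y, B X⟫_ℂ).re := rfl

theorem reMatrixCoeff_star_mul (Y X : K) (B C : K →L[ℂ] K) :
    reMatrixCoeff Y X (star B * C) = (⟪B Y, C X⟫_ℂ).re := by
  rw [reMatrixCoeff_apply, ContinuousLinearMap.star_eq_adjoint, mul_apply_eq_comp,
    ContinuousLinearMap.adjoint_inner_right]

theorem reMatrixCoeff_star_mul_self (X : K) (B : K →L[ℂ] K) :
    reMatrixCoeff X X (star B * B) = ‖B X‖ ^ 2 := by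
  rw [reMatrixCoeff_star_mul]
  exact inner_self_eq_norm_sq (𝕜 := ℂ) (B X)

theorem reMatrixCoeff_star_mul_mul (X : K) (B C : K →L[ℂ] K) :
    reMatrixCoeff X X (star B * C * B) = reMatrixCoeff (B X) (B X) C := by
  rw [mul_assoc, reMatrixCoeff_star_mul, reMatrixCoeff_apply, mul_apply_eq_comp]

omit [CompleteSpace K] in
theorem reMatrixCoeff_ofReal_smul (Y X : K) (s : ℝ) (B : K →L[ℂ] K) :
    reMatrixCoeff Y X ((s : ℂ) • B) = s * reMatrixCoeff Y X B := by
  rw [reMatrixCoeff_apply, reMatrixCoeff_apply, smul_apply, inner_smul_right,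
    Complex.re_ofReal_mul]

theorem circleAverage_reMatrixCoeff {f : ℂ → K →L[ℂ] K} {c : ℝ} (hf : CircleIntegrable f 0 c)
    (Y X : K) : circleAverage (fun z => reMatrixCoeff Y X (f z)) 0 c =
      reMatrixCoeff Y X (circleAverage f 0 c) :=
  (reMatrixCoeff Y X).circleAverage_comp_comm hf

theorem reMatrixCoeff_circleAverage_nonneg {f : ℂ → K →L[ℂ] K} {c : ℝ}
    (hf : CircleIntegrable f 0 c) (hc : 0 < c) (X : K)
    (h : ∀ z : ℂ, ‖z‖ = c → 0 ≤ reMatrixCoeff X X (f z)) :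
    0 ≤ reMatrixCoeff X X (circleAverage f 0 c) := by
  rw [← circleAverage_reMatrixCoeff hf]
  exact circleAverage_nonneg_of_nonneg fun z hz => h z (by simpa [abs_of_pos hc] using hz)

namespace SpectrumInAnnulus

theorem integrable_form {c : ℝ} (hc : 0 < c)
    (hu : ∀ z : ℂ, ‖z‖ = c → IsUnit (algebraMap ℂ (K →L[ℂ] K) z - T)) (X : K →L[ℂ] K) :
    CircleIntegrable (fun z => star (scaledResolvent T z) * X * scaledResolvent T z) 0 c :=
  circleIntegrable_of_continuousAt hc fun z hz =>
    ((continuousAt_scaledResolvent (hu z hz)).star.mul continuousAt_const).mul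
      (continuousAt_scaledResolvent (hu z hz))

variable {S : K →L[ℂ] K}

theorem reMatrixCoeff_form_nonneg (hS : star S * S = hereditaryForm a b T) {c : ℝ} (hc : 0 < c)
    (hu : ∀ z : ℂ, ‖z‖ = c → IsUnit (algebraMap ℂ (K →L[ℂ] K) z - T)) (X : K) :
    0 ≤ reMatrixCoeff X X (circleAverage (fun z => star (scaledResolvent T z) *
      hereditaryForm a b T * scaledResolvent T z) 0 c) := by
  refine reMatrixCoeff_circleAverage_nonneg (integrable_form hc hu _) hc X fun z hz => ?_
  rw [reMatrixCoeff_star_mul_mul, ← hS, reMatrixCoeff_star_mul_self]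
  positivity

theorem reMatrixCoeff_outer_nonneg (h : SpectrumInAnnulus a b T)
    (hS : star S * S = hereditaryForm a b T) (X : K) :
    0 ≤ reMatrixCoeff X X (star T * T - ((a ^ 2 : ℝ) : ℂ) • 1) := by
  have := reMatrixCoeff_form_nonneg hS h.pos' (fun z hz => h.outer z hz.ge) X
  rw [h.circleAverage_outer, reMatrixCoeff_ofReal_smul] at this
  exact nonneg_of_mul_nonneg_right this (pow_pos h.pos' 2)

theorem reMatrixCoeff_inner_nonneg (h : SpectrumInAnnulus a b T)
    (hS : star S * S = hereditaryForm a b T) (X : K) :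
    0 ≤ reMatrixCoeff X X (((b ^ 2 : ℝ) : ℂ) • 1 - star T * T) := by
  have := reMatrixCoeff_form_nonneg hS h.pos (fun z hz => h.inner z hz.le) X
  rw [h.circleAverage_inner, reMatrixCoeff_ofReal_smul] at this
  exact nonneg_of_mul_nonneg_right this (pow_pos h.pos 2)

theorem form_eq_sub (X : K →L[ℂ] K) (c d : ℝ) : ((d ^ 2 : ℝ) : ℂ) • X - star T * X * T =
    (((c ^ 2 : ℝ) : ℂ) • X - star T * X * T) + ((d ^ 2 - c ^ 2 : ℝ) : ℂ) • X := by
  rw [Complex.ofReal_sub, sub_smul]; abel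

theorem circleAverage_form_eq {c d : ℝ} (hc : 0 < c)
    (hu : ∀ z : ℂ, ‖z‖ = c → IsUnit (algebraMap ℂ (K →L[ℂ] K) z - T)) (X : K →L[ℂ] K) :
    circleAverage (fun z => star (scaledResolvent T z) *
      (((d ^ 2 : ℝ) : ℂ) • X - star T * X * T) * scaledResolvent T z) 0 c =
    ((c ^ 2 : ℝ) : ℂ) • (star (circleAverage (scaledResolvent T) 0 c) * X +
      X * circleAverage (scaledResolvent T) 0 c - X) + ((d ^ 2 - c ^ 2 : ℝ) : ℂ) •
      circleAverage (fun z => star (scaledResolvent T z) * X * scaledResolvent T z) 0 c := by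
  rw [← circleAverage_star_mul_mul hc hu, ← circleAverage_fun_smul, ← circleAverage_fun_add]
  · simp only [form_eq_sub X c d, mul_add, add_mul, mul_smul_comm, smul_mul_assoc]
  · exact integrable_form hc hu _
  · exact IntervalIntegrable.smul (integrable_form hc hu X) ((d ^ 2 - c ^ 2 : ℝ) : ℂ)

/-- With `X = T*T - a²`, the form is `(c² X - T* X T) + (b² - c²) X`. The first part averages to
exactly `c² X`; the second contributes a nonpositive amount because `X ≥ 0` and `c ≥ b`. -/
theorem reMatrixCoeff_form_outer_le (h : SpectrumInAnnulus a b T)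
    (hS : star S * S = hereditaryForm a b T) {c : ℝ} (hbc : b ≤ c) (X : K) :
    reMatrixCoeff X X (circleAverage (fun z => star (scaledResolvent T z) *
      hereditaryForm a b T * scaledResolvent T z) 0 c) ≤
    c ^ 2 * reMatrixCoeff X X (star T * T - ((a ^ 2 : ℝ) : ℂ) • 1) := by
  have hc : 0 < c := h.pos'.trans_le hbc
  have hu : ∀ z : ℂ, ‖z‖ = c → IsUnit (algebraMap ℂ (K →L[ℂ] K) z - T) :=
    fun z hz => h.outer z (hbc.trans_eq hz.symm)
  rw [hereditaryForm_eq_outer, circleAverage_form_eq hc hu,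
    circleAverage_scaledResolvent_outer h.pos' h.outer hbc, map_add, reMatrixCoeff_ofReal_smul,
    reMatrixCoeff_ofReal_smul, star_one, one_mul, mul_one, add_sub_cancel_right]
  have h1 := reMatrixCoeff_circleAverage_nonneg
    (integrable_form hc hu (star T * T - ((a ^ 2 : ℝ) : ℂ) • 1)) hc X fun z _ => by
      rw [reMatrixCoeff_star_mul_mul]; exact h.reMatrixCoeff_outer_nonneg hS _
  have h2 : b ^ 2 - c ^ 2 ≤ 0 := sub_nonpos.2 (pow_le_pow_left₀ h.pos'.le hbc 2)
  linarith [mul_nonpos_of_nonpos_of_nonneg h2 h1]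

theorem reMatrixCoeff_form_inner_le (h : SpectrumInAnnulus a b T)
    (hS : star S * S = hereditaryForm a b T) {c : ℝ} (hc : 0 < c) (hca : c ≤ a) (X : K) :
    reMatrixCoeff X X (circleAverage (fun z => star (scaledResolvent T z) *
      hereditaryForm a b T * scaledResolvent T z) 0 c) ≤
    c ^ 2 * reMatrixCoeff X X (((b ^ 2 : ℝ) : ℂ) • 1 - star T * T) := by
  have hu : ∀ z : ℂ, ‖z‖ = c → IsUnit (algebraMap ℂ (K →L[ℂ] K) z - T) :=
    fun z hz => h.inner z (hz.trans_le hca)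
  -- The operator in the role of `X` is now `-(b² - T*T) ≤ 0`. The sign of `a² - c²` is reversed too
  -- compared with the outer case, so the error term is again nonpositive.
  have e : hereditaryForm a b T =
      ((a ^ 2 : ℝ) : ℂ) • (-(((b ^ 2 : ℝ) : ℂ) • 1 - star T * T))
      - star T * (-(((b ^ 2 : ℝ) : ℂ) • 1 - star T * T)) * T := by
    rw [hereditaryForm_eq_inner]
    simp only [mul_neg, neg_mul, smul_neg]; abel
  rw [e, circleAverage_form_eq hc hu,
    circleAverage_scaledResolvent_inner h.inner hc hca, map_add, reMatrixCoeff_ofReal_smul,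
    reMatrixCoeff_ofReal_smul, star_zero, zero_mul, mul_zero, add_zero, zero_sub, neg_neg]
  have h1 : reMatrixCoeff X X (circleAverage (fun z => star (scaledResolvent T z) *
      (-(((b ^ 2 : ℝ) : ℂ) • 1 - star T * T)) * scaledResolvent T z) 0 c) ≤ 0 := by
    rw [← circleAverage_reMatrixCoeff (integrable_form hc hu _), ← neg_nonneg]
    have : 0 ≤ circleAverage (fun z => (-1 : ℝ) • reMatrixCoeff X X (star (scaledResolvent T z) *
      (-(((b ^ 2 : ℝ) : ℂ) • 1 - star T * T)) * scaledResolvent T z)) 0 c := by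
      refine circleAverage_nonneg_of_nonneg fun z _ => ?_
      rw [reMatrixCoeff_star_mul_mul, map_neg, smul_eq_mul, neg_mul_neg, one_mul]
      exact h.reMatrixCoeff_inner_nonneg hS _
    rw [circleAverage_fun_smul] at this
    simpa using this
  have h2 : 0 ≤ a ^ 2 - c ^ 2 := sub_nonneg.2 (pow_le_pow_left₀ hc.le hca 2)
  linarith [mul_nonpos_of_nonneg_of_nonpos h2 h1]

end SpectrumInAnnulus

theorem circleIntegrable_mul_const_mul {c : ℝ} (hc : 0 < c) {U V : ℂ → K →L[ℂ] K}
    (X : K →L[ℂ] K) (hU : ∀ z : ℂ, ‖z‖ = c → ContinuousAt U z)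
    (hV : ∀ z : ℂ, ‖z‖ = c → ContinuousAt V z) :
    CircleIntegrable (fun z => U z * X * V z) 0 c :=
  circleIntegrable_of_continuousAt hc fun z hz =>
    ((hU z hz).mul continuousAt_const).mul (hV z hz)

theorem star_circleWeight_mul_mul (X : K →L[ℂ] K) (c d : ℝ) (z : ℂ) :
    star (circleWeight T c d z) * X * circleWeight T c d z =
    ((c ^ 2 : ℝ) : ℂ)⁻¹ • (((c ^ 2 : ℝ) : ℂ)⁻¹ • (star (scaledResolvent T z) * X *
        scaledResolvent T z) - ((d ^ 2 : ℝ) : ℂ)⁻¹ • (star (scaledResolvent T z) * X *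
        scaledResolvent T (((d ^ 2 / c ^ 2 : ℝ) : ℂ) * z))) -
    ((d ^ 2 : ℝ) : ℂ)⁻¹ • (((c ^ 2 : ℝ) : ℂ)⁻¹ •
      (star (scaledResolvent T (((d ^ 2 / c ^ 2 : ℝ) : ℂ) * z)) * X * scaledResolvent T z) -
      ((d ^ 2 : ℝ) : ℂ)⁻¹ • (star (scaledResolvent T (((d ^ 2 / c ^ 2 : ℝ) : ℂ) * z)) * X *
        scaledResolvent T (((d ^ 2 / c ^ 2 : ℝ) : ℂ) * z))) := by
  rw [star_circleWeight_mul, circleWeight]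
  simp only [sub_mul, mul_sub, smul_mul_assoc, mul_smul_comm, smul_sub, smul_smul]
  rw [mul_comm (((d ^ 2 : ℝ) : ℂ)⁻¹) (((c ^ 2 : ℝ) : ℂ)⁻¹)]
  abel

/-- Expanding the square of the weight leaves only the two diagonal terms. The substitution `z ↦
d²z/c²` carries the circle of radius `c` to that of radius `d²/c`, which accounts for the second
average. -/
theorem circleAverage_circleWeight_form {X : K →L[ℂ] K} {c d : ℝ} (hc : 0 < c)
    (h1 : ∀ z : ℂ, ‖z‖ = c → ContinuousAt (scaledResolvent T) z)
    (h2 : ∀ z : ℂ, ‖z‖ = c →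
      ContinuousAt (fun z : ℂ => scaledResolvent T (((d ^ 2 / c ^ 2 : ℝ) : ℂ) * z)) z)
    (e1 : circleAverage (fun z => star (scaledResolvent T z) * X *
        scaledResolvent T (((d ^ 2 / c ^ 2 : ℝ) : ℂ) * z)) 0 c = 0)
    (e2 : circleAverage (fun z => star (scaledResolvent T (((d ^ 2 / c ^ 2 : ℝ) : ℂ) * z)) * X *
        scaledResolvent T z) 0 c = 0) :
    circleAverage (fun z => star (circleWeight T c d z) * X * circleWeight T c d z) 0 c =
      (((c ^ 2)⁻¹ ^ 2 : ℝ) : ℂ) • circleAverage (fun z => star (scaledResolvent T z) * X *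
        scaledResolvent T z) 0 c +
      (((d ^ 2)⁻¹ ^ 2 : ℝ) : ℂ) • circleAverage (fun z => star (scaledResolvent T z) * X *
        scaledResolvent T z) 0 (d ^ 2 / c) := by
  have i1 := circleIntegrable_mul_const_mul hc X (fun z hz => (h1 z hz).star) h1
  have i2 := circleIntegrable_mul_const_mul hc X (fun z hz => (h1 z hz).star) h2
  have i3 := circleIntegrable_mul_const_mul hc X (fun z hz => (h2 z hz).star) h1
  have i4 := circleIntegrable_mul_const_mul hc X (fun z hz => (h2 z hz).star) h2
  have e3 : d ^ 2 / c = d ^ 2 / c ^ 2 * c := by field_simp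
  simp only [star_circleWeight_mul_mul]
  rw [circleAverage_smul_sub_smul, circleAverage_smul_sub_smul i1 i2,
    circleAverage_smul_sub_smul i3 i4, e1, e2, e3,
    circleAverage_comp_mul (fun z => star (scaledResolvent T z) * X * scaledResolvent T z)]
  · simp only [smul_zero, sub_zero, zero_sub, smul_neg, sub_neg_eq_add, smul_smul, pow_two,
      Complex.ofReal_mul, Complex.ofReal_inv]
  · exact IntervalIntegrable.sub (IntervalIntegrable.smul i1 (((c ^ 2 : ℝ) : ℂ)⁻¹)) (IntervalIntegrable.smul i2 (((d ^ 2 : ℝ) : ℂ)⁻¹))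
  · exact IntervalIntegrable.sub (IntervalIntegrable.smul i3 (((c ^ 2 : ℝ) : ℂ)⁻¹)) (IntervalIntegrable.smul i4 (((d ^ 2 : ℝ) : ℂ)⁻¹))

end Estimate

/-! ### The norm estimate with constant `√2` -/

section Bound

variable {K : Type*} [NormedAddCommGroup K] [InnerProductSpace ℂ K] [CompleteSpace K]
  {T S : K →L[ℂ] K} {a b : ℝ}

namespace SpectrumInAnnulus

theorem reMatrixCoeff_add (T : K →L[ℂ] K) (a b : ℝ) (X : K) :
    reMatrixCoeff X X (star T * T - ((a ^ 2 : ℝ) : ℂ) • 1) +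
      reMatrixCoeff X X (((b ^ 2 : ℝ) : ℂ) • 1 - star T * T) = (b ^ 2 - a ^ 2) * ‖X‖ ^ 2 := by
  have h1 : reMatrixCoeff X X (1 : K →L[ℂ] K) = ‖X‖ ^ 2 := by
    simpa using reMatrixCoeff_star_mul_self X (1 : K →L[ℂ] K)
  rw [map_sub, map_sub, reMatrixCoeff_ofReal_smul, reMatrixCoeff_ofReal_smul, h1]
  ring

/-- The direct term gives exactly `T*T - a²`. The reflected term lives on the circle of radius `a²/b
≤ a`, where the inner bound gives at most `b² - T*T`; the factors `b² a⁻⁴ (a²/b)²` multiply to `1`,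
and the two operators add up to `b² - a²`. -/
theorem circleWeight_outer_le (h : SpectrumInAnnulus a b T)
    (hS : star S * S = hereditaryForm a b T) (Y : K) :
    b ^ 2 * reMatrixCoeff Y Y (circleAverage (fun z => star (circleWeight T b a z) *
      hereditaryForm a b T * circleWeight T b a z) 0 b) ≤ (b ^ 2 - a ^ 2) * ‖Y‖ ^ 2 := by
  have ha := h.pos
  have hb := h.pos'
  have hle : a ^ 2 / b ≤ a := by
    rw [div_le_iff₀ hb, pow_two]; exact mul_le_mul_of_nonneg_left h.lt.le ha.le
  have h1 := h.reMatrixCoeff_form_inner_le hS (c := a ^ 2 / b) (by positivity) hle Y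
  rw [circleAverage_circleWeight_form hb (fun z => h.continuousAt_outer)
    (fun z => h.continuousAt_outer_scaled) (h.circleAverage_outer_cross' _)
    (h.circleAverage_outer_cross _), h.circleAverage_outer, map_add, reMatrixCoeff_ofReal_smul,
    reMatrixCoeff_ofReal_smul, reMatrixCoeff_ofReal_smul, ← reMatrixCoeff_add T]
  calc _ = reMatrixCoeff Y Y (star T * T - ((a ^ 2 : ℝ) : ℂ) • 1) +
        b ^ 2 * (a ^ 2)⁻¹ ^ 2 * reMatrixCoeff Y Y (circleAverage (fun z =>
          star (scaledResolvent T z) * hereditaryForm a b T * scaledResolvent T z) 0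
          (a ^ 2 / b)) := by
        field_simp
    _ ≤ reMatrixCoeff Y Y (star T * T - ((a ^ 2 : ℝ) : ℂ) • 1) +
        b ^ 2 * (a ^ 2)⁻¹ ^ 2 * ((a ^ 2 / b) ^ 2 *
          reMatrixCoeff Y Y (((b ^ 2 : ℝ) : ℂ) • 1 - star T * T)) := by gcongr
    _ = _ := by field_simp

theorem circleWeight_inner_le (h : SpectrumInAnnulus a b T)
    (hS : star S * S = hereditaryForm a b T) (Y : K) :
    a ^ 2 * reMatrixCoeff Y Y (circleAverage (fun z => star (circleWeight T a b z) *
      hereditaryForm a b T * circleWeight T a b z) 0 a) ≤ (b ^ 2 - a ^ 2) * ‖Y‖ ^ 2 := by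
  have ha := h.pos
  have hb := h.pos'
  have hle : b ≤ b ^ 2 / a := by
    rw [le_div_iff₀ ha, pow_two]; exact mul_le_mul_of_nonneg_left h.lt.le hb.le
  have h1 := h.reMatrixCoeff_form_outer_le hS (c := b ^ 2 / a) hle Y
  rw [circleAverage_circleWeight_form ha (fun z => h.continuousAt_inner)
    (fun z => h.continuousAt_inner_scaled) (h.circleAverage_inner_cross' _)
    (h.circleAverage_inner_cross _), h.circleAverage_inner, map_add, reMatrixCoeff_ofReal_smul,
    reMatrixCoeff_ofReal_smul, reMatrixCoeff_ofReal_smul, ← reMatrixCoeff_add T]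
  calc _ = reMatrixCoeff Y Y (((b ^ 2 : ℝ) : ℂ) • 1 - star T * T) +
        a ^ 2 * (b ^ 2)⁻¹ ^ 2 * reMatrixCoeff Y Y (circleAverage (fun z =>
          star (scaledResolvent T z) * hereditaryForm a b T * scaledResolvent T z) 0
          (b ^ 2 / a)) := by
        field_simp
    _ ≤ reMatrixCoeff Y Y (((b ^ 2 : ℝ) : ℂ) • 1 - star T * T) +
        a ^ 2 * (b ^ 2)⁻¹ ^ 2 * ((b ^ 2 / a) ^ 2 *
          reMatrixCoeff Y Y (star T * T - ((a ^ 2 : ℝ) : ℂ) • 1)) := by gcongr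
    _ = _ := by field_simp; ring

/-- Splitting `S* S` between the two sides and moving `Φ` to the left of `S R` reduces the claim to
a pointwise Cauchy–Schwarz inequality for `S W Y` and `Φ (S R X)`. -/
theorem reMatrixCoeff_circle_le {c M : ℝ} (hc : 0 < c) {W R Φ : ℂ → K →L[ℂ] K}
    (hW : ∀ z : ℂ, ‖z‖ = c → ContinuousAt W z) (hR : ∀ z : ℂ, ‖z‖ = c → ContinuousAt R z)
    (hΦ : ∀ z : ℂ, ‖z‖ = c → ContinuousAt Φ z) (hM : ∀ z : ℂ, ‖z‖ = c → ‖Φ z‖ ≤ M)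
    (hcomm : ∀ z : ℂ, ‖z‖ = c → S * (R z * Φ z) = Φ z * (S * R z)) (Y X : K) :
    reMatrixCoeff Y X (circleAverage (fun z => star (W z) * (star S * S) * (R z * Φ z)) 0 c) ≤
      c ^ 2 / 4 * reMatrixCoeff Y Y (circleAverage (fun z => star (W z) * (star S * S) * W z) 0 c) +
      M ^ 2 / c ^ 2 * reMatrixCoeff X X
        (circleAverage (fun z => star (R z) * (star S * S) * R z) 0 c) := by
  have i1 := circleIntegrable_mul_const_mul hc (star S * S) (fun z hz => (hW z hz).star)
    (V := fun z => R z * Φ z) fun z hz => (hR z hz).mul (hΦ z hz)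
  have i2 := circleIntegrable_mul_const_mul hc (star S * S) (fun z hz => (hW z hz).star) hW
  have i3 := circleIntegrable_mul_const_mul hc (star S * S) (fun z hz => (hR z hz).star) hR
  have j1 : ∀ (U V : K) {f : ℂ → K →L[ℂ] K}, CircleIntegrable f 0 c →
      CircleIntegrable (fun z => reMatrixCoeff U V (f z)) 0 c := fun U V f hf =>
    ⟨(reMatrixCoeff U V).integrable_comp hf.1, (reMatrixCoeff U V).integrable_comp hf.2⟩
  have j2 : CircleIntegrable (fun z => (c ^ 2 / 4) •
      reMatrixCoeff Y Y (star (W z) * (star S * S) * W z)) 0 c := (j1 Y Y i2).const_fun_smul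
  have j3 : CircleIntegrable (fun z => (M ^ 2 / c ^ 2) •
      reMatrixCoeff X X (star (R z) * (star S * S) * R z)) 0 c := (j1 X X i3).const_fun_smul
  rw [← circleAverage_reMatrixCoeff i1, ← circleAverage_reMatrixCoeff i2,
    ← circleAverage_reMatrixCoeff i3, ← smul_eq_mul (c ^ 2 / 4),
    ← smul_eq_mul (M ^ 2 / c ^ 2), ← circleAverage_fun_smul,
    ← circleAverage_fun_smul, ← circleAverage_fun_add j2 j3]
  refine circleAverage_mono (j1 Y X i1) (IntervalIntegrable.add j2 j3) fun z hz => ?_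
  replace hz : ‖z‖ = c := by simpa [abs_of_pos hc] using hz
  have e1 : star (W z) * (star S * S) * (R z * Φ z) = star (S * W z) * (Φ z * (S * R z)) := by
    rw [← hcomm z hz, star_mul]; simp only [mul_assoc]
  have e2 : ∀ V : K →L[ℂ] K, star V * (star S * S) * V = star (S * V) * (S * V) := by
    intro V; rw [star_mul]; simp only [mul_assoc]
  simp only [e2]
  rw [e1, reMatrixCoeff_star_mul, reMatrixCoeff_star_mul_self, reMatrixCoeff_star_mul_self,
    smul_eq_mul, smul_eq_mul, mul_apply_eq_comp (Φ z)]
  set u := (S * W z) Y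
  set v := (S * R z) X
  have hv : ‖Φ z v‖ ≤ M * ‖v‖ := (Φ z).le_of_opNorm_le (hM z hz) v
  have hM0 : 0 ≤ M := (norm_nonneg _).trans (hM z hz)
  calc (⟪u, Φ z v⟫_ℂ).re ≤ ‖u‖ * ‖Φ z v‖ := (Complex.re_le_norm _).trans (norm_inner_le_norm _ _)
    _ ≤ ‖u‖ * (M * ‖v‖) := by gcongr
    -- The factors `c / 2` and `M / c` make the two weight terms sum to at most half of `(b² -
    -- a²)‖Y‖²`, so they can be absorbed, while `c²` cancels against the averages of the form.
    _ = 2 * (c / 2 * ‖u‖) * (M / c * ‖v‖) := by field_simp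
    _ ≤ (c / 2 * ‖u‖) ^ 2 + (M / c * ‖v‖) ^ 2 := two_mul_le_add_sq _ _
    _ = _ := by ring

/-- The norm estimate on an annulus whose interior contains the spectrum. -/
theorem norm_le (h : SpectrumInAnnulus a b T) (hS : star S * S = hereditaryForm a b T)
    {Φ G : ℂ → K →L[ℂ] K} {B : K →L[ℂ] K} {M : ℝ}
    (hG : ∀ z : ℂ, a ≤ ‖z‖ → ‖z‖ ≤ b → DifferentiableAt ℂ G z)
    (hΦ : ∀ z : ℂ, a ≤ ‖z‖ → ‖z‖ ≤ b → (algebraMap ℂ (K →L[ℂ] K) z - T) * G z = Φ z - B)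
    (hΦc : ∀ z : ℂ, a ≤ ‖z‖ → ‖z‖ ≤ b → ContinuousAt Φ z)
    (hM : ∀ z : ℂ, a ≤ ‖z‖ → ‖z‖ ≤ b → ‖Φ z‖ ≤ M)
    (hT : ∀ z : ℂ, Commute T (Φ z)) (hSΦ : ∀ z : ℂ, Commute S (Φ z)) :
    ‖B‖ ≤ √2 * M := by
  have ha := h.pos
  have hb := h.pos'
  have hab := h.lt.le
  have hM0 : 0 ≤ M := (norm_nonneg _).trans
    (hM (b : ℂ) (by simp [abs_of_pos hb, hab]) (by simp [abs_of_pos hb]))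
  have hcomm : ∀ z : ℂ, IsUnit (algebraMap ℂ (K →L[ℂ] K) z - T) →
      S * (scaledResolvent T z * Φ z) = Φ z * (S * scaledResolvent T z) := by
    intro z hz
    have h1 : Commute (algebraMap ℂ (K →L[ℂ] K) z - T) (Φ z) :=
      Commute.sub_left (Algebra.commutes z (Φ z)) (hT z)
    have h2 : Commute (resolvent T z) (Φ z) := by
      obtain ⟨u, hu⟩ := hz
      rw [resolvent, ← hu, Ring.inverse_unit]
      rw [← hu] at h1
      exact h1.units_inv_left
    have h3 : Commute (scaledResolvent T z) (Φ z) := h2.smul_left z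
    exact (hSΦ z).mul_left h3 |>.eq ▸ (mul_assoc _ _ _).symm
  refine ContinuousLinearMap.opNorm_le_bound _ (by positivity) fun X => ?_
  -- Testing against `Y = B X` makes the represented quantity `(b² - a²)‖Y‖²`, which also occurs,
  -- halved, on the other side of the estimate.
  set Y := B X with hY
  have h1 := congrArg (reMatrixCoeff Y X) (h.representation hG hΦ hΦc)
  rw [map_add, reMatrixCoeff_ofReal_smul, reMatrixCoeff_apply _ _ B, ← hY] at h1
  have h2 : (⟪Y, Y⟫_ℂ).re = ‖Y‖ ^ 2 := inner_self_eq_norm_sq (𝕜 := ℂ) Y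
  have h3 := reMatrixCoeff_circle_le hb (S := S) (fun z => h.continuousAt_circleWeight_outer)
    (fun z => h.continuousAt_outer) (fun z hz => hΦc z (hab.trans_eq hz.symm) hz.le)
    (fun z hz => hM z (hab.trans_eq hz.symm) hz.le) (fun z hz => hcomm z (h.isUnit_outer hz)) Y X
  have h4 := reMatrixCoeff_circle_le ha (S := S) (fun z => h.continuousAt_circleWeight_inner)
    (fun z => h.continuousAt_inner) (fun z hz => hΦc z hz.ge (hz.trans_le hab))
    (fun z hz => hM z hz.ge (hz.trans_le hab)) (fun z hz => hcomm z (h.isUnit_inner hz)) Y X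
  rw [hS, h.circleAverage_outer, reMatrixCoeff_ofReal_smul] at h3
  rw [hS, h.circleAverage_inner, reMatrixCoeff_ofReal_smul] at h4
  have h5 := h.circleWeight_outer_le hS Y
  have h6 := h.circleWeight_inner_le hS Y
  have h7 := reMatrixCoeff_add T a b X
  have e1 : ∀ c q : ℝ, 0 < c → M ^ 2 / c ^ 2 * (c ^ 2 * q) = M ^ 2 * q := by
    intro c q hc; field_simp
  rw [e1 _ _ hb] at h3
  rw [e1 _ _ ha] at h4
  have hpos : 0 < b ^ 2 - a ^ 2 := sub_pos.2 (pow_lt_pow_left₀ h.lt ha.le two_ne_zero)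
  have h8 : (b ^ 2 - a ^ 2) * ‖Y‖ ^ 2 ≤ (b ^ 2 - a ^ 2) * (‖Y‖ ^ 2 / 2 + M ^ 2 * ‖X‖ ^ 2) := by
    have h9 := congrArg (M ^ 2 * ·) h7
    simp only [mul_add] at h9
    rw [h2] at h1
    linarith
  have h9 := le_of_mul_le_mul_left h8 hpos
  apply le_of_sq_le_sq _ (by positivity)
  rw [mul_pow, mul_pow, Real.sq_sqrt zero_le_two]
  linarith

end SpectrumInAnnulus

end Bound

/-! ### Operator matrices on `Hⁿ`: diagonal and scalar blocks -/

section Block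

variable {H : Type*} [NormedAddCommGroup H] [InnerProductSpace ℂ H] {n : ℕ}

/-- `blockOp` as an algebra homomorphism. -/
def blockAlgHom (H : Type*) [NormedAddCommGroup H] [InnerProductSpace ℂ H] (n : ℕ) :
    Matrix (Fin n) (Fin n) (H →L[ℂ] H) →ₐ[ℂ]
      (PiLp 2 (fun _ : Fin n => H) →L[ℂ] PiLp 2 (fun _ : Fin n => H)) :=
  AlgHom.ofLinearMap
    { toFun := blockOp
      map_add' := fun A B => by
        ext x i
        simp [blockOp_apply, Finset.sum_add_distrib]
      map_smul' := fun c A => by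
        ext x i
        simp [blockOp_apply, Finset.smul_sum] }
    (by
      ext x i
      simp [blockOp_apply, Matrix.one_apply, ite_apply, apply_ite])
    (fun A B => by
      ext x i
      simp only [LinearMap.coe_mk, AddHom.coe_mk, blockOp_apply, mul_apply_eq_comp, Matrix.mul_apply,
        sum_apply, map_sum]
      exact Finset.sum_comm)

theorem blockAlgHom_apply (A : Matrix (Fin n) (Fin n) (H →L[ℂ] H)) :
    blockAlgHom H n A = blockOp A := rfl

theorem star_blockAlgHom [CompleteSpace H] (A : Matrix (Fin n) (Fin n) (H →L[ℂ] H)) :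
    star (blockAlgHom H n A) = blockAlgHom H n (star A) := by
  rw [ContinuousLinearMap.star_eq_adjoint, eq_comm, ContinuousLinearMap.eq_adjoint_iff]
  intro x y
  simp only [blockAlgHom_apply, PiLp.inner_apply, blockOp_apply, sum_inner, inner_sum,
    Matrix.star_apply, ContinuousLinearMap.star_eq_adjoint, ContinuousLinearMap.adjoint_inner_left]
  exact Finset.sum_comm

/-- The diagonal operator on `Hⁿ`. -/
def ampliation (n : ℕ) : (H →L[ℂ] H) →ₐ[ℂ]
    (PiLp 2 (fun _ : Fin n => H) →L[ℂ] PiLp 2 (fun _ : Fin n => H)) :=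
  (blockAlgHom H n).comp (Matrix.scalarAlgHom (Fin n) ℂ)

theorem ampliation_apply (B : H →L[ℂ] H) :
    ampliation n B = blockAlgHom H n (Matrix.scalar (Fin n) B) := rfl

theorem star_ampliation [CompleteSpace H] (B : H →L[ℂ] H) :
    star (ampliation n B) = ampliation n (star B) := by
  rw [ampliation_apply, star_blockAlgHom, ampliation_apply]
  congr 1
  simp [Matrix.star_eq_conjTranspose, Matrix.diagonal_conjTranspose]

/-- The operator on `Hⁿ` given by a complex matrix. -/
def scalarBlock (H : Type*) [NormedAddCommGroup H] [InnerProductSpace ℂ H] (n : ℕ) :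
    Matrix (Fin n) (Fin n) ℂ →ₐ[ℂ]
      (PiLp 2 (fun _ : Fin n => H) →L[ℂ] PiLp 2 (fun _ : Fin n => H)) :=
  (blockAlgHom H n).comp (Algebra.ofId ℂ (H →L[ℂ] H)).mapMatrix

theorem scalarBlock_apply (A : Matrix (Fin n) (Fin n) ℂ) :
    scalarBlock H n A = blockAlgHom H n (A.map (algebraMap ℂ (H →L[ℂ] H))) := rfl

theorem star_scalarBlock [CompleteSpace H] (A : Matrix (Fin n) (Fin n) ℂ) :
    star (scalarBlock H n A) = scalarBlock H n (star A) := by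
  rw [scalarBlock_apply, star_blockAlgHom, scalarBlock_apply]
  congr 1
  ext i j : 1
  simp [Matrix.star_apply, Algebra.algebraMap_eq_smul_one]

/-- Star homomorphisms between C*-algebras are contractive. Composing with the inverse of
`Matrix.toEuclideanCLM` gives such a homomorphism on the operators of `ℂⁿ`, where the norm is the
Euclidean operator norm. -/
theorem norm_scalarBlock_le [CompleteSpace H] (A : Matrix (Fin n) (Fin n) ℂ) :
    ‖scalarBlock H n A‖ ≤ ‖Matrix.toEuclideanCLM (n := Fin n) (𝕜 := ℂ) A‖ := by
  let φ : Matrix (Fin n) (Fin n) ℂ →⋆ₐ[ℂ]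
      (PiLp 2 (fun _ : Fin n => H) →L[ℂ] PiLp 2 (fun _ : Fin n => H)) :=
    { scalarBlock H n with map_star' := fun A => (star_scalarBlock A).symm }
  let ψ := φ.comp (Matrix.toEuclideanCLM (n := Fin n) (𝕜 := ℂ)).symm.toStarAlgHom
  have h := NonUnitalStarAlgHom.norm_apply_le ψ (Matrix.toEuclideanCLM (n := Fin n) (𝕜 := ℂ) A)
  have e : ψ (Matrix.toEuclideanCLM (n := Fin n) (𝕜 := ℂ) A) = scalarBlock H n A := by
    change scalarBlock H n ((Matrix.toEuclideanCLM (n := Fin n) (𝕜 := ℂ)).symm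
      (Matrix.toEuclideanCLM (n := Fin n) (𝕜 := ℂ) A)) = _
    rw [StarAlgEquiv.symm_apply_apply]
  rwa [e] at h

theorem commute_ampliation_scalarBlock (B : H →L[ℂ] H) (A : Matrix (Fin n) (Fin n) ℂ) :
    Commute (ampliation n B) (scalarBlock H n A) := by
  rw [ampliation_apply, scalarBlock_apply]
  apply Commute.map
  ext i j : 1
  simp [Matrix.diagonal_mul, Matrix.mul_diagonal, Algebra.commutes]

theorem map_hereditaryForm {A B : Type*} [CStarAlgebra A] [CStarAlgebra B] (φ : A →ₐ[ℂ] B)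
    (hφ : ∀ x, star (φ x) = φ (star x)) (a b : ℝ) (T : A) :
    φ (hereditaryForm a b T) = hereditaryForm a b (φ T) := by
  simp only [hereditaryForm, map_sub, map_add, map_neg, map_mul, map_pow, map_smul, map_one, hφ]

theorem SpectrumInAnnulus.map_ampliation [CompleteSpace H] {a b : ℝ} {T : H →L[ℂ] H}
    (h : SpectrumInAnnulus a b T) : SpectrumInAnnulus a b (ampliation n T) where
  pos := h.pos
  lt := h.lt
  inner z hz := by
    have := (h.inner z hz).map (ampliation (H := H) n)
    rwa [map_sub, AlgHom.commutes] at this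
  outer z hz := by
    have := (h.outer z hz).map (ampliation (H := H) n)
    rwa [map_sub, AlgHom.commutes] at this

end Block

/-! ### Holomorphic difference quotients for polynomials and rational functions -/

section Rational

open Polynomial

theorem exists_differenceQuotient {A : Type*} [NormedRing A] [NormedAlgebra ℂ A] (T : A)
    (p : ℂ[X]) : ∃ g : ℂ → A, Differentiable ℂ g ∧
      ∀ z : ℂ, (algebraMap ℂ A z - T) * g z = algebraMap ℂ A (p.eval z) - aeval T p := by
  induction p using Polynomial.induction_on' with
  | add p q hp hq =>
    obtain ⟨g, hg, hg'⟩ := hp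
    obtain ⟨k, hk, hk'⟩ := hq
    refine ⟨fun z => g z + k z, hg.add hk, fun z => ?_⟩
    rw [mul_add, hg', hk', eval_add, map_add, map_add]
    abel
  | monomial m c =>
    induction m with
    | zero => exact ⟨0, differentiable_const 0, fun z => by simp⟩
    | succ m ih =>
      obtain ⟨g, hg, hg'⟩ := ih
      refine ⟨fun z => algebraMap ℂ A ((monomial m c).eval z) + T * g z, ?_, fun z => ?_⟩
      · refine Differentiable.add ?_ (hg.const_mul T)
        simp only [Algebra.algebraMap_eq_smul_one]
        exact (Polynomial.differentiable _).smul_const 1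
      · have h1 : (algebraMap ℂ A z - T) * (T * g z) = T * ((algebraMap ℂ A z - T) * g z) := by
          rw [← mul_assoc, ← mul_assoc, sub_mul, mul_sub, Algebra.commutes]
        have h2 : monomial (m + 1) c = X * monomial m c := by
          rw [X_mul_monomial]
        rw [mul_add, h1, hg', h2, map_mul, aeval_X, eval_mul, eval_X, map_mul]
        noncomm_ring

theorem exists_differenceQuotient_ratFunc {H : Type*} [NormedAddCommGroup H]
    [InnerProductSpace ℂ H] (T : H →L[ℂ] H) (f : RatFunc ℂ)
    (hT : IsUnit (aeval T f.denom)) : ∃ g : ℂ → H →L[ℂ] H,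
      (∀ z : ℂ, f.denom.eval z ≠ 0 → DifferentiableAt ℂ g z) ∧
      ∀ z : ℂ, f.denom.eval z ≠ 0 → (algebraMap ℂ (H →L[ℂ] H) z - T) * g z =
        algebraMap ℂ (H →L[ℂ] H) (f.eval (RingHom.id ℂ) z) - ratFuncOp f T := by
  obtain ⟨g, hg, hg'⟩ := exists_differenceQuotient T f.num
  obtain ⟨k, hk, hk'⟩ := exists_differenceQuotient T f.denom
  -- For `f = p/q`, `p(z) - p(T) - (q(z) - q(T)) f(T) = q(z) (f(z) - f(T))`, because `q(T) f(T) =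
  -- p(T)`.
  refine ⟨fun z => (f.denom.eval z)⁻¹ • (g z - k z * ratFuncOp f T), fun z hz => ?_,
    fun z hz => ?_⟩
  · exact ((Polynomial.differentiable _ z).inv hz).smul ((hg z).sub ((hk z).mul_const _))
  · have h1 : aeval T f.denom * ratFuncOp f T = aeval T f.num := by
      rw [ratFuncOp, ← mul_assoc, ← map_mul, mul_comm, map_mul, mul_assoc,
        Ring.mul_inverse_cancel _ hT, mul_one]
    rw [mul_smul_comm, mul_sub, ← mul_assoc, hg', hk', sub_mul, h1, RatFunc.eval,
      sub_sub_sub_cancel_right, smul_sub, ← Algebra.smul_def, smul_smul, inv_mul_cancel₀ hz,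
      one_smul, Algebra.algebraMap_eq_smul_one, Algebra.algebraMap_eq_smul_one, smul_smul,
      Polynomial.eval₂_id, Polynomial.eval₂_id, div_eq_inv_mul]

theorem isUnit_aeval_of_spectrum_subset {A : Type*} [NormedRing A] [NormedAlgebra ℂ A]
    [CompleteSpace A] {T : A} {X : Set ℂ} (h : spectrum ℂ T ⊆ X) {q : ℂ[X]}
    (hq : ∀ z ∈ X, q.eval z ≠ 0) : IsUnit (aeval T q) := by
  -- Spectral mapping is used for a nonempty spectrum, which fails in the zero algebra; there
  -- everything is a unit.
  rcases subsingleton_or_nontrivial A with hA | hA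
  · exact isUnit_of_subsingleton _
  · have h1 := spectrum.map_polynomial_aeval_of_nonempty T q (spectrum.nonempty T)
    rw [← spectrum.zero_notMem_iff ℂ, h1]
    rintro ⟨z, hz, h0⟩
    exact hq z (h hz) h0

end Rational

/-! ### Entrywise regularity of operator matrices -/

section BlockContinuity

variable {H : Type*} [NormedAddCommGroup H] [InnerProductSpace ℂ H] {n : ℕ}

/-- The operator on `Hⁿ` whose only nonzero block is at the position `(i, j)`. -/
def blockEntry (H : Type*) [NormedAddCommGroup H] [InnerProductSpace ℂ H] (i j : Fin n) :
    (H →L[ℂ] H) →L[ℂ] (PiLp 2 (fun _ : Fin n => H) →L[ℂ] PiLp 2 (fun _ : Fin n => H)) :=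
  (ContinuousLinearMap.compL ℂ (PiLp 2 (fun _ : Fin n => H)) H (PiLp 2 (fun _ : Fin n => H))
      (((PiLp.continuousLinearEquiv 2 ℂ (fun _ : Fin n => H)).symm :
        (Fin n → H) →L[ℂ] PiLp 2 (fun _ : Fin n => H)) ∘L
        ContinuousLinearMap.single ℂ (fun _ : Fin n => H) i)) ∘L
    ((ContinuousLinearMap.compL ℂ (PiLp 2 (fun _ : Fin n => H)) H H).flip
      (PiLp.proj 2 (fun _ : Fin n => H) j))

theorem blockEntry_apply (i j : Fin n) (B : H →L[ℂ] H) (x : PiLp 2 (fun _ : Fin n => H))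
    (k : Fin n) : blockEntry H i j B x k = if k = i then B (x j) else 0 := by
  simp [blockEntry]

theorem blockAlgHom_eq_sum (A : Matrix (Fin n) (Fin n) (H →L[ℂ] H)) :
    blockAlgHom H n A = ∑ i, ∑ j, blockEntry H i j (A i j) := by
  ext x k
  rw [blockAlgHom_apply, blockOp_apply]
  simp only [sum_apply, WithLp.ofLp_sum, Finset.sum_apply, blockEntry_apply]
  rw [Finset.sum_comm]
  simp

theorem differentiableAt_sum_sum {E F : Type*} [NormedAddCommGroup E] [NormedSpace ℂ E]
    [NormedAddCommGroup F] [NormedSpace ℂ F] (L : Fin n → Fin n → E →L[ℂ] F)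
    {A : ℂ → Matrix (Fin n) (Fin n) E} {z : ℂ}
    (hA : ∀ i j, DifferentiableAt ℂ (fun z => A z i j) z) :
    DifferentiableAt ℂ (fun z => ∑ i, ∑ j, L i j (A z i j)) z :=
  DifferentiableAt.fun_sum fun i _ => DifferentiableAt.fun_sum fun j _ =>
    (L i j).differentiableAt.comp z (hA i j)

theorem continuousAt_sum_sum {E F : Type*} [NormedAddCommGroup E] [NormedSpace ℂ E]
    [NormedAddCommGroup F] [NormedSpace ℂ F] (L : Fin n → Fin n → E →L[ℂ] F)
    {A : ℂ → Matrix (Fin n) (Fin n) E} {z : ℂ}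
    (hA : ∀ i j, ContinuousAt (fun z => A z i j) z) :
    ContinuousAt (fun z => ∑ i, ∑ j, L i j (A z i j)) z :=
  tendsto_finsetSum _ fun i _ => tendsto_finsetSum _ fun j _ =>
    (L i j).continuous.continuousAt.comp (hA i j)

theorem differentiableAt_blockAlgHom {A : ℂ → Matrix (Fin n) (Fin n) (H →L[ℂ] H)} {z : ℂ}
    (hA : ∀ i j, DifferentiableAt ℂ (fun z => A z i j) z) :
    DifferentiableAt ℂ (fun z => blockAlgHom H n (A z)) z := by
  have h := differentiableAt_sum_sum
    (F := PiLp 2 (fun _ : Fin n => H) →L[ℂ] PiLp 2 (fun _ : Fin n => H))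
    (fun i j => blockEntry H i j) hA
  exact h.congr_of_eventuallyEq (Filter.Eventually.of_forall fun z => blockAlgHom_eq_sum (A z))

theorem continuousAt_blockAlgHom {A : ℂ → Matrix (Fin n) (Fin n) (H →L[ℂ] H)} {z : ℂ}
    (hA : ∀ i j, ContinuousAt (fun z => A z i j) z) :
    ContinuousAt (fun z => blockAlgHom H n (A z)) z := by
  have h := continuousAt_sum_sum
    (F := PiLp 2 (fun _ : Fin n => H) →L[ℂ] PiLp 2 (fun _ : Fin n => H))
    (fun i j => blockEntry H i j) hA
  exact h.congr (Filter.Eventually.of_forall fun z => (blockAlgHom_eq_sum (A z)).symm)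

end BlockContinuity

/-! ### Continuity of the values of a rational matrix -/

section Values

variable {n : ℕ}

theorem continuousAt_ratFunc_eval {f : RatFunc ℂ} {z : ℂ} (hz : f.denom.eval z ≠ 0) :
    ContinuousAt (fun z => f.eval (RingHom.id ℂ) z) z := by
  simp only [RatFunc.eval, Polynomial.eval₂_id]
  exact (Polynomial.continuous _).continuousAt.div (Polynomial.continuous _).continuousAt hz

theorem continuousAt_valueNorm {F : Matrix (Fin n) (Fin n) (RatFunc ℂ)} {z : ℂ}
    (hz : ∀ i j, (F i j).denom.eval z ≠ 0) : ContinuousAt (valueNorm F) z := by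
  have h1 : ContinuousAt (fun z => F.map (RatFunc.eval (RingHom.id ℂ) z)) z :=
    continuousAt_pi.2 fun i => continuousAt_pi.2 fun j => continuousAt_ratFunc_eval (hz i j)
  have h2 : Continuous fun A : Matrix (Fin n) (Fin n) ℂ =>
      Matrix.toEuclideanCLM (n := Fin n) (𝕜 := ℂ) A :=
    LinearMap.continuous_of_finiteDimensional
      (Matrix.toEuclideanCLM (n := Fin n) (𝕜 := ℂ)).toAlgEquiv.toLinearMap
  exact (h2.continuousAt.comp h1).norm

end Values

/-! ### Location of the spectrum and enlargement of the annulus -/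

section Spectrum

variable {H : Type*} [NormedAddCommGroup H] [InnerProductSpace ℂ H] [CompleteSpace H]

theorem reMatrixCoeff_hereditaryForm (a b : ℝ) (T : H →L[ℂ] H) (x : H) :
    reMatrixCoeff x x (hereditaryForm a b T) =
      -‖T (T x)‖ ^ 2 + (a ^ 2 + b ^ 2) * ‖T x‖ ^ 2 - a ^ 2 * b ^ 2 * ‖x‖ ^ 2 := by
  have h1 : reMatrixCoeff x x (1 : H →L[ℂ] H) = ‖x‖ ^ 2 := by
    simpa using reMatrixCoeff_star_mul_self x (1 : H →L[ℂ] H)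
  rw [hereditaryForm, map_sub, map_add, map_neg, reMatrixCoeff_ofReal_smul,
    reMatrixCoeff_ofReal_smul, ← star_pow, reMatrixCoeff_star_mul_self,
    reMatrixCoeff_star_mul_self, h1, pow_two T, mul_apply_eq_comp]

/-- The inequality forces `T` to be power bounded, while a spectral value of modulus greater than
`1` would make `‖T ^ m‖` grow geometrically. -/
theorem norm_le_one_of_mem_spectrum {r : ℝ} (hr1 : r ^ 2 < 1) {T : H →L[ℂ] H}
    (hT : ∀ x, ‖T (T x)‖ ^ 2 ≤ (1 + r ^ 2) * ‖T x‖ ^ 2 - r ^ 2 * ‖x‖ ^ 2) {z : ℂ}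
    (hz : z ∈ spectrum ℂ T) : ‖z‖ ≤ 1 := by
  have hr : 0 < 1 - r ^ 2 := sub_pos.2 hr1
  -- Chosen so that `C ≥ 1` and `r² C + ‖T‖² ≤ C`, the start and the induction step of the power
  -- bound.
  set C := 1 + ‖T‖ ^ 2 / (1 - r ^ 2) with hC
  have hCpos : 0 ≤ C := by positivity
  -- By hypothesis `‖T^(m+1) x‖² - r² ‖T^m x‖²` does not increase with `m`, so it stays below its
  -- value at `m = 0`.
  have hstep : ∀ (x : H) (m : ℕ),
      ‖(T ^ (m + 1)) x‖ ^ 2 - r ^ 2 * ‖(T ^ m) x‖ ^ 2 ≤ ‖T‖ ^ 2 * ‖x‖ ^ 2 := by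
    intro x m
    induction m with
    | zero =>
      have h1 : ‖T x‖ ^ 2 ≤ (‖T‖ * ‖x‖) ^ 2 := by gcongr; exact T.le_opNorm x
      rw [mul_pow] at h1
      simp only [zero_add, pow_one, pow_zero, one_apply_eq_self]
      nlinarith [sq_nonneg (r * ‖x‖)]
    | succ m ih =>
      have h1 := hT ((T ^ m) x)
      rw [← mul_apply_eq_comp T (T ^ m), ← pow_succ', ← mul_apply_eq_comp T (T ^ (m + 1)),
        ← pow_succ'] at h1
      linarith
  have hbound : ∀ (x : H) (m : ℕ), ‖(T ^ m) x‖ ^ 2 ≤ C * ‖x‖ ^ 2 := by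
    intro x m
    induction m with
    | zero =>
      simp only [pow_zero, one_apply_eq_self]
      have : 0 ≤ ‖T‖ ^ 2 / (1 - r ^ 2) * ‖x‖ ^ 2 := by positivity
      rw [hC]; linarith
    | succ m ih =>
      have h1 := hstep x m
      have h2 : (1 - r ^ 2) * C = 1 - r ^ 2 + ‖T‖ ^ 2 := by rw [hC]; field_simp
      have h3 := mul_le_mul_of_nonneg_left ih (sq_nonneg r)
      nlinarith [mul_nonneg hr.le (sq_nonneg ‖x‖)]
  have hpow : ∀ m : ℕ, ‖T ^ m‖ ≤ √C := fun m => by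
    refine ContinuousLinearMap.opNorm_le_bound _ (sqrt_nonneg _) fun x => ?_
    apply le_of_sq_le_sq _ (by positivity)
    rw [mul_pow, sq_sqrt hCpos]
    exact hbound x m
  by_contra! h
  obtain ⟨m, hm⟩ := pow_unbounded_of_one_lt (√C * ‖(1 : H →L[ℂ] H)‖) h
  have h1 := spectrum.norm_le_norm_mul_of_mem (spectrum.pow_mem_pow T m hz)
  rw [norm_pow] at h1
  exact absurd (h1.trans (mul_le_mul_of_nonneg_right (hpow m) (norm_nonneg _))) (not_le.2 hm)

theorem spectrum_subset_closedAnnulus {r : ℝ} (hr0 : 0 < r) (hr1 : r < 1) {T : H →L[ℂ] H}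
    (hu : IsUnit T) (hT : ∀ x, ‖T (T x)‖ ^ 2 ≤ (1 + r ^ 2) * ‖T x‖ ^ 2 - r ^ 2 * ‖x‖ ^ 2) :
    spectrum ℂ T ⊆ closedAnnulus r := by
  have hr2 : r ^ 2 < 1 := pow_lt_one₀ hr0.le hr1 two_ne_zero
  intro z hz
  refine ⟨?_, norm_le_one_of_mem_spectrum hr2 hT hz⟩
  obtain ⟨u, rfl⟩ := hu
  have hz0 : z ≠ 0 := spectrum.ne_zero_of_mem_of_unit hz
  -- The lower bound comes from symmetry: `r T⁻¹` satisfies the same inequality as `T`, as seen by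
  -- evaluating the latter at `T⁻² x` and multiplying by `r²`. Hence `|r / z| ≤ 1`.
  have h1 : (Units.mk0 (r : ℂ) (by exact_mod_cast hr0.ne')) • z⁻¹ ∈
      spectrum ℂ ((Units.mk0 (r : ℂ) (by exact_mod_cast hr0.ne')) • (↑u⁻¹ : H →L[ℂ] H)) := by
    rw [spectrum.smul_mem_smul_iff]
    have := (spectrum.inv_mem_iff (r := (Units.mk0 z hz0)⁻¹) (a := u⁻¹)).2 (by simpa using hz)
    simpa using this
  have h2 := norm_le_one_of_mem_spectrum hr2 (fun x => ?_) h1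
  · change ‖(r : ℂ) * z⁻¹‖ ≤ 1 at h2
    rw [norm_mul, norm_inv, Complex.norm_real, norm_of_nonneg hr0.le, ← div_eq_mul_inv,
      div_le_one (by positivity)] at h2
    exact h2
  · change ‖(r : ℂ) • (↑u⁻¹ : H →L[ℂ] H) ((r : ℂ) • (↑u⁻¹ : H →L[ℂ] H) x)‖ ^ 2 ≤
      (1 + r ^ 2) * ‖(r : ℂ) • (↑u⁻¹ : H →L[ℂ] H) x‖ ^ 2 - r ^ 2 * ‖x‖ ^ 2
    have huu : ∀ y : H, (u : H →L[ℂ] H) ((↑u⁻¹ : H →L[ℂ] H) y) = y := fun y => by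
      rw [← mul_apply_eq_comp, Units.mul_inv, one_apply_eq_self]
    have h3 := hT ((↑u⁻¹ : H →L[ℂ] H) ((↑u⁻¹ : H →L[ℂ] H) x))
    rw [huu, huu] at h3
    simp only [map_smul, norm_smul, Complex.norm_real, norm_of_nonneg hr0.le, mul_pow]
    nlinarith [sq_nonneg r]

theorem alphaOp_eq_hereditaryForm (r : ℝ) (T : H →L[ℂ] H) : alphaOp r T = hereditaryForm r 1 T := by
  simp only [alphaOp, hereditaryForm, ContinuousLinearMap.star_eq_adjoint, one_pow, mul_one,
    add_comm]

/-- The radii `r/ρ` and `ρ` keep the product `r`, so only the coefficient of `T* T` changes, and it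
grows by `(ρ² - 1)(ρ² - r²)/ρ² ≥ 0`. -/
theorem hereditaryForm_nonneg {r ρ : ℝ} (hr0 : 0 < r) (hr1 : r < 1) (hρ : 1 < ρ) {T : H →L[ℂ] H}
    (hT : 0 ≤ hereditaryForm r 1 T) : 0 ≤ hereditaryForm (r / ρ) ρ T := by
  have hρ0 : 0 < ρ := one_pos.trans hρ
  have hδ : 0 ≤ (r / ρ) ^ 2 + ρ ^ 2 - (r ^ 2 + 1 ^ 2) := by
    have h1 : (r / ρ) ^ 2 + ρ ^ 2 - (r ^ 2 + 1 ^ 2) = (ρ ^ 2 - 1) * (ρ ^ 2 - r ^ 2) / ρ ^ 2 := by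
      field_simp; ring
    rw [h1]
    have h2 : 0 ≤ ρ ^ 2 - 1 := by nlinarith
    have h3 : 0 ≤ ρ ^ 2 - r ^ 2 := by nlinarith
    positivity
  have e : hereditaryForm (r / ρ) ρ T = hereditaryForm r 1 T +
      star (((√((r / ρ) ^ 2 + ρ ^ 2 - (r ^ 2 + 1 ^ 2)) : ℝ) : ℂ) • T) *
        (((√((r / ρ) ^ 2 + ρ ^ 2 - (r ^ 2 + 1 ^ 2)) : ℝ) : ℂ) • T) := by
    have h1 : (r / ρ) ^ 2 * ρ ^ 2 = r ^ 2 * 1 ^ 2 := by field_simp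
    rw [star_smul, smul_mul_smul_comm, Complex.star_def, Complex.conj_ofReal, ← Complex.ofReal_mul,
      mul_self_sqrt hδ, hereditaryForm, hereditaryForm, h1, Complex.ofReal_sub, sub_smul]
    abel
  rw [e]
  exact add_nonneg hT (star_mul_self_nonneg _)

end Spectrum

/-! ### Matrix-valued functions and passage to the closed annulus -/

section Main

variable {H : Type*} [NormedAddCommGroup H] [InnerProductSpace ℂ H] [CompleteSpace H] {n : ℕ}

theorem SpectrumInAnnulus.norm_blockOp_le {a b : ℝ} {T S : H →L[ℂ] H}
    (h : SpectrumInAnnulus a b T) (hS : star S * S = hereditaryForm a b T)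
    {F : Matrix (Fin n) (Fin n) (RatFunc ℂ)}
    (hF : ∀ i j, ∀ z : ℂ, a ≤ ‖z‖ → ‖z‖ ≤ b → (F i j).denom.eval z ≠ 0) {M : ℝ}
    (hM : ∀ z : ℂ, a ≤ ‖z‖ → ‖z‖ ≤ b → valueNorm F z ≤ M) :
    ‖blockOp (F.map fun f => ratFuncOp f T)‖ ≤ √2 * M := by
  have hspec : spectrum ℂ T ⊆ {z : ℂ | a ≤ ‖z‖ ∧ ‖z‖ ≤ b} := by
    intro z hz
    constructor
    · by_contra! hlt
      exact spectrum.mem_iff.1 hz (h.inner z hlt.le)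
    · by_contra! hlt
      exact spectrum.mem_iff.1 hz (h.outer z hlt.le)
  choose g hg hg' using fun i j => exists_differenceQuotient_ratFunc T (F i j)
    (isUnit_aeval_of_spectrum_subset hspec fun z hz => hF i j z hz.1 hz.2)
  -- The scalar estimate is applied on `Hⁿ`: the values `F(z)` act as scalar matrices, which commute
  -- with the diagonal operators built from `T` and `S`.
  refine (h.map_ampliation (n := n)).norm_le (S := ampliation n S)
    (Φ := fun z => scalarBlock H n (F.map (RatFunc.eval (RingHom.id ℂ) z)))
    (G := fun z => blockAlgHom H n (Matrix.of fun i j => g i j z)) ?_ ?_ ?_ ?_ ?_ ?_ ?_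
  · rw [star_ampliation, ← map_mul, hS, map_hereditaryForm _ star_ampliation]
  · exact fun z h1 h2 => differentiableAt_blockAlgHom fun i j => hg i j z (hF i j z h1 h2)
  · intro z h1 h2
    rw [← AlgHom.commutes (ampliation (H := H) n), ← map_sub, ampliation_apply, ← map_mul,
      scalarBlock_apply, ← blockAlgHom_apply, ← map_sub]
    congr 1
    ext i j : 1
    simp only [Matrix.scalar_apply, Matrix.diagonal_mul, Matrix.of_apply, Matrix.sub_apply,
      Matrix.map_apply]
    exact hg' i j z (hF i j z h1 h2)
  · intro z h1 h2
    simp only [scalarBlock_apply]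
    refine continuousAt_blockAlgHom fun i j => ?_
    exact (continuous_algebraMap ℂ (H →L[ℂ] H)).continuousAt.comp
      (continuousAt_ratFunc_eval (hF i j z h1 h2))
  · exact fun z h1 h2 => (norm_scalarBlock_le _).trans (hM z h1 h2)
  · exact fun z => commute_ampliation_scalarBlock _ _
  · exact fun z => commute_ampliation_scalarBlock _ _

theorem isCompact_closedAnnulus (r : ℝ) : IsCompact (closedAnnulus r) := by
  refine (isCompact_closedBall (0 : ℂ) 1).of_isClosed_subset ?_ fun z hz => by simpa using hz.2
  exact (isClosed_le continuous_const continuous_norm).inter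
    (isClosed_le continuous_norm continuous_const)

theorem exists_annulus_subset {r : ℝ} (hr0 : 0 < r) (hr1 : r < 1) {V : Set ℂ} (hV : IsOpen V)
    (h : closedAnnulus r ⊆ V) :
    ∃ ρ : ℝ, 1 < ρ ∧ ∀ z : ℂ, r / ρ ≤ ‖z‖ → ‖z‖ ≤ ρ → z ∈ V := by
  obtain ⟨δ, hδ, hsub⟩ := (isCompact_closedAnnulus r).exists_thickening_subset_open hV h
  have hρ : 0 < 1 + δ / 2 := by positivity
  -- Radial projection onto the closed annulus moves `z` by at most `δ / 2`: outside by `ρ - 1`,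
  -- inside by `r - r/ρ`, which is smaller as `r < 1`.
  refine ⟨1 + δ / 2, by linarith, fun z h1 h2 => hsub ?_⟩
  have hz : 0 < ‖z‖ := (div_pos hr0 hρ).trans_le h1
  have key : ∀ s : ℝ, 0 < s → dist z (((s / ‖z‖ : ℝ) : ℂ) * z) = |‖z‖ - s| := by
    intro s hs
    have : z - ((s / ‖z‖ : ℝ) : ℂ) * z = (((‖z‖ - s) / ‖z‖ : ℝ) : ℂ) * z := by
      have : (‖z‖ : ℂ) ≠ 0 := by exact_mod_cast hz.ne'
      push_cast
      field_simp
    rw [dist_eq_norm, this, norm_mul, Complex.norm_real, norm_div, norm_norm,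
      div_mul_cancel₀ _ hz.ne', Real.norm_eq_abs]
  have key' : ∀ s : ℝ, 0 < s → ‖((s / ‖z‖ : ℝ) : ℂ) * z‖ = s := by
    intro s hs
    rw [norm_mul, Complex.norm_real, norm_of_nonneg (by positivity), div_mul_cancel₀ _ hz.ne']
  rw [mem_thickening_iff]
  rcases le_or_gt ‖z‖ 1 with h3 | h3
  · rcases le_or_gt r ‖z‖ with h4 | h4
    · exact ⟨z, ⟨h4, h3⟩, by simpa using hδ⟩
    · refine ⟨((r / ‖z‖ : ℝ) : ℂ) * z, ?_, ?_⟩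
      · rw [closedAnnulus, Set.mem_ofPred_eq, key' r hr0]
        exact ⟨le_rfl, hr1.le⟩
      · rw [key r hr0, abs_of_neg (sub_neg.2 h4)]
        rw [div_le_iff₀ hρ] at h1
        nlinarith
  · refine ⟨((1 / ‖z‖ : ℝ) : ℂ) * z, ?_, ?_⟩
    · rw [closedAnnulus, Set.mem_ofPred_eq, key' 1 one_pos]
      exact ⟨hr1.le, le_rfl⟩
    · rw [key 1 one_pos, abs_of_pos (sub_pos.2 h3)]
      linarith

end Main

end AnnulusModel

end

open AnnulusModel in
theorem theorem4p2 {H : Type*} [NormedAddCommGroup H] [InnerProductSpace ℂ H] [CompleteSpace H]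
    (r : ℝ) (hr0 : 0 < r) (hr1 : r < 1) (T : H →L[ℂ] H) (hT : AnnulusModel.MemCAlpha r T) :
    AnnulusModel.IsCompleteSpectralSet (AnnulusModel.closedAnnulus r) (Real.sqrt 2) T := by
  obtain ⟨hu, hpos⟩ := hT
  rw [alphaOp_eq_hereditaryForm] at hpos
  have hspec : spectrum ℂ T ⊆ closedAnnulus r := by
    refine spectrum_subset_closedAnnulus hr0 hr1 hu fun x => ?_
    have h1 : 0 ≤ reMatrixCoeff x x (hereditaryForm r 1 T) := hpos.re_inner_nonneg_right x
    rw [reMatrixCoeff_hereditaryForm] at h1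
    linarith
  refine ⟨hspec, fun n F hF => le_of_forall_pos_le_add fun ε hε => ?_⟩
  set M := sSup (valueNorm F '' closedAnnulus r) with hMdef
  have h2 : (0 : ℝ) < Real.sqrt 2 := by positivity
  have hcont : ContinuousOn (valueNorm F) (closedAnnulus r) := fun z hz =>
    (continuousAt_valueNorm fun i j => hF i j z hz).continuousWithinAt
  have hle : ∀ z ∈ closedAnnulus r, valueNorm F z ≤ M := fun z hz =>
    le_csSup ((isCompact_closedAnnulus r).bddAbove_image hcont) ⟨z, hz, rfl⟩
  have hU : IsOpen {z : ℂ | ∀ i j, (F i j).denom.eval z ≠ 0} := by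
    simp only [Set.ofPred_forall]
    exact isOpen_iInter_of_finite fun i => isOpen_iInter_of_finite fun j =>
      isOpen_ne_fun (Polynomial.continuous _) continuous_const
  -- On this open neighbourhood of the closed annulus there are no poles and `‖F(z)‖ < M + ε/√2`;
  -- the factor `√2` of the estimate turns the excess into exactly `ε`.
  have hV := ContinuousOn.isOpen_inter_preimage
    (fun z hz => (continuousAt_valueNorm hz).continuousWithinAt) hU
    (isOpen_Iio (a := M + ε / Real.sqrt 2)) (f := valueNorm F)
  obtain ⟨ρ, hρ, hsub⟩ := exists_annulus_subset hr0 hr1 hV fun z hz =>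
    ⟨fun i j => hF i j z hz, lt_of_le_of_lt (hle z hz) (lt_add_of_pos_right M (by positivity))⟩
  have hρ0 : 0 < ρ := one_pos.trans hρ
  have hrρ : r / ρ < r := div_lt_self hr0 hρ
  have h : SpectrumInAnnulus (r / ρ) ρ T := by
    refine ⟨by positivity, by linarith, fun z hz => ?_, fun z hz => ?_⟩
    · exact spectrum.notMem_iff.1 fun h => absurd (hspec h).1 (by linarith)
    · exact spectrum.notMem_iff.1 fun h => absurd (hspec h).2 (by linarith)
  obtain ⟨S, hS⟩ := CStarAlgebra.nonneg_iff_eq_star_mul_self.1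
    (hereditaryForm_nonneg hr0 hr1 hρ ((ContinuousLinearMap.nonneg_iff_isPositive _).2 hpos))
  have h3 := h.norm_blockOp_le hS.symm (fun i j z hz1 hz2 => (hsub z hz1 hz2).1 i j)
    (fun z hz1 hz2 => le_of_lt (hsub z hz1 hz2).2)
  rwa [mul_add, mul_div_cancel₀ _ h2.ne'] at h3
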